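/- **Descent cone of the nuclear norm.** Let $n_1\le n_2$ and equip $\mathbb{R}^{n_1\times n_2}$ with the Frobenius inner product $\langle X,Y\rangle=\mathrm{Tr}(X^TY)$. For $X\in\mathbb{R}^{n_1\times n_2}$ let $\sigma_1(X)\ge\dots\ge\sigma_{n_1}(X)\ge 0$ be its singular values, let $\|X\|_*=\sum_i\sigma_i(X)$ be its nuclear norm, and let $\mathcal{O}(X)$ be the set of all pairs $(U,V)$ of orthogonal matrices $U\in\mathbb{R}^{n_1\times n_1}$, $V\in\mathbb{R}^{n_2\times n_2}$ with $X=U\,\mathrm{Diag}(\sigma(X))\,V^T$, where $\mathrm{Diag}(\sigma(X))$ is the $n_1\times n_2$ matrix with $\sigma_1(X),\dots,\sigma_{n_1}(X)$ on its main diagonal and zeros elsewhere. Write $\mathbb{S}^k$ and $\mathbb{S}^k_+$ for the symmetric and the symmetric positive semidefinite $k\times k$ real matrices. Let $X_0\in\mathbb{R}^{n_1\times n_2}$ and $r=\mathrm{rank}(X_0)$. Let $$\mathcal{D}(X_0)=\mathbb{R}_+\{X-X_0\mid \|X\|_*\le\|X_0\|_*\}$$ be the descent cone of the nuclear norm at $X_0$,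 and let $\mathcal{C}(X_0)=\{W\mid \lim_{t\downarrow0}\frac{\|X_0+tW\|_*-\|X_0\|_*}{t}\le 0\}$ be its critical cone at $X_0$. Then $$\mathcal{D}(X_0)=\mathcal{E}\cup \mathrm{int}\,\mathcal{C}(X_0),$$ where $\mathcal{E}$ is the set of all matrices $$U\begin{pmatrix}A&BC&0\\ C^TB^T&C&0\end{pmatrix}V^T\in\mathbb{R}^{n_1\times n_2}$$ with $(U,V)\in\mathcal{O}(X_0)$, $A\in\mathbb{S}^r$, $B\in\mathbb{R}^{r\times(n_1-r)}$, $C\in\mathbb{S}^{n_1-r}_+$ and $\mathrm{Tr}(A)+\mathrm{Tr}(C)=0$. Moreover, let $\Phi:\mathbb{R}^{n_1\times n_2}\to\mathbb{R}^m$ be linear, let $M_0\in\mathbb{R}^m$, and suppose that $X_0$ is an optimal solution of $$\min_{X\in\mathbb{R}^{n_1\times n_2}}\ \|X\|_*\quad\text{subject to}\quad \Phi X=M_0.$$ Then for every dual certificate $Y\in\partial\|X_0\|_*\cap\mathrm{Im}\,\Phi^*$, with $p=\#\{i\mid\sigma_i(Y)=1\}$, and for every pair $(U,V)\in\mathcal{O}(X_0)\cap\mathcal{O}(Y)$,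 one has $$\mathrm{Ker}\,\Phi\cap\mathcal{D}(X_0)=\mathrm{Ker}\,\Phi\cap\left\{U\begin{pmatrix}A&BC&0\\ C^TB^T&C&0\\ 0&0&0\end{pmatrix}V^T\ \middle|\ A\in\mathbb{S}^r,\ B\in\mathbb{R}^{r\times(p-r)},\ C\in\mathbb{S}^{p-r}_+,\ \mathrm{Tr}(A)+\mathrm{Tr}(C)=0\right\}.$$ -/

import Mathlib

open scoped Matrix Topology

noncomputable section

/-! ### Descent cone and critical cone of a real function -/

section Cones

variable {E : Type*} [AddCommGroup E] [Module ℝ E]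

/-- The descent cone `cone {x - x₀ | g x ≤ g x₀}`, where `cone S = ℝ₊ S`. -/
def descentCone (g : E → ℝ) (x₀ : E) : Set E :=
  {w | ∃ t : ℝ, 0 ≤ t ∧ ∃ x : E, g x ≤ g x₀ ∧ w = t • (x - x₀)}

/-- `d` is the (one-sided) directional derivative `lim_{t ↓ 0} (g (x₀ + t w) - g x₀) / t`. -/
def HasDirDeriv (g : E → ℝ) (x₀ w : E) (d : ℝ) : Prop :=
  Filter.Tendsto (fun t : ℝ => (g (x₀ + t • w) - g x₀) / t) (𝓝[>] 0) (𝓝 d)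

/-- The critical cone: the directions in which the directional derivative is at most `0`. -/
def criticalCone (g : E → ℝ) (x₀ : E) : Set E :=
  {w | ∃ d : ℝ, HasDirDeriv g x₀ w d ∧ d ≤ 0}

end Cones

/-! ### Singular values, nuclear norm, singular value decompositions -/

/-- The `i`-th singular value of `X`, in decreasing order and counted from `0`. -/
def sigma {n₁ n₂ : ℕ} (X : Matrix (Fin n₁) (Fin n₂) ℝ) (i : ℕ) : ℝ :=
  (Matrix.toEuclideanLin X).singularValues i

/-- The nuclear norm: the sum of all singular values (those of index `≥ n₁` are zero). -/
def nuclearNorm {n₁ n₂ : ℕ} (X : Matrix (Fin n₁) (Fin n₂) ℝ) : ℝ :=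
  ∑ i : Fin n₁, sigma X i

/-- The number of singular values of `Y` that are equal to `1`. -/
def unitSingularCount {n₁ n₂ : ℕ} (Y : Matrix (Fin n₁) (Fin n₂) ℝ) : ℕ :=
  (Finset.univ.filter fun i : Fin n₁ => sigma Y i = 1).card

/-- The `n₁ × n₂` matrix with the ordered singular values of `X` on its main diagonal. -/
def diagSigma {n₁ n₂ : ℕ} (X : Matrix (Fin n₁) (Fin n₂) ℝ) : Matrix (Fin n₁) (Fin n₂) ℝ :=
  Matrix.of fun i j => if (i : ℕ) = (j : ℕ) then sigma X i else 0

/-- The pairs `(U, V)` of orthogonal matrices such that `X = U (Diag σ(X)) Vᵀ`. -/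
def svdPairs {n₁ n₂ : ℕ} (X : Matrix (Fin n₁) (Fin n₂) ℝ) :
    Set (Matrix (Fin n₁) (Fin n₁) ℝ × Matrix (Fin n₂) (Fin n₂) ℝ) :=
  {P | P.1 ∈ Matrix.orthogonalGroup (Fin n₁) ℝ ∧ P.2 ∈ Matrix.orthogonalGroup (Fin n₂) ℝ ∧
    X = P.1 * diagSigma X * P.2ᵀ}

/-! ### Block matrices -/

/-- The `n₁ × n₂` matrix with upper left block `M`, of size `(r + q) × (r + q)`, and zeros
elsewhere (used for `r + q ≤ n₁` and `r + q ≤ n₂`). -/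
def padBlock (n₁ n₂ : ℕ) {r q : ℕ} (M : Matrix (Fin r ⊕ Fin q) (Fin r ⊕ Fin q) ℝ) :
    Matrix (Fin n₁) (Fin n₂) ℝ :=
  Matrix.of fun i j =>
    if h : (i : ℕ) < r + q ∧ (j : ℕ) < r + q then
      M (finSumFinEquiv.symm ⟨i, h.1⟩) (finSumFinEquiv.symm ⟨j, h.2⟩)
    else 0

/-- For given `U`, `V` and block sizes `r`, `q`, the matrices
`U [[A, BC, 0], [CᵀBᵀ, C, 0], [0, 0, 0]] Vᵀ` with `A` symmetric of size `r`, `B` of size `r × q`,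
`C` symmetric positive semidefinite of size `q` and `Tr A + Tr C = 0`. -/
def traceZeroBlocks {n₁ n₂ : ℕ} (r q : ℕ) (U : Matrix (Fin n₁) (Fin n₁) ℝ)
    (V : Matrix (Fin n₂) (Fin n₂) ℝ) : Set (Matrix (Fin n₁) (Fin n₂) ℝ) :=
  {W | ∃ (A : Matrix (Fin r) (Fin r) ℝ) (B : Matrix (Fin r) (Fin q) ℝ)
      (C : Matrix (Fin q) (Fin q) ℝ),
    A.IsSymm ∧ C.PosSemidef ∧ A.trace + C.trace = 0 ∧
      W = U * padBlock n₁ n₂ (Matrix.fromBlocks A (B * C) (Cᵀ * Bᵀ) C) * Vᵀ}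

/-- The set `ℰ`: here `q = n₁ - r` with `r = rank X₀ ≤ n₁` (so that the third block row is empty),
and `(U, V)` ranges over all pairs of the singular value decomposition of `X₀`. -/
def descentBoundary {n₁ n₂ : ℕ} (X₀ : Matrix (Fin n₁) (Fin n₂) ℝ) :
    Set (Matrix (Fin n₁) (Fin n₂) ℝ) :=
  {W | ∃ U V, (U, V) ∈ svdPairs X₀ ∧ W ∈ traceZeroBlocks X₀.rank (n₁ - X₀.rank) U V}

/-! ### Nuclear norm minimization and dual certificates -/

/-- The Frobenius inner product `Tr (Xᵀ Y)`. -/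
def frobInner {n₁ n₂ : ℕ} (X Y : Matrix (Fin n₁) (Fin n₂) ℝ) : ℝ := (Xᵀ * Y).trace

/-- The subdifferential of a real function on matrices, for the Frobenius inner product. -/
def subdifferential {n₁ n₂ : ℕ} (g : Matrix (Fin n₁) (Fin n₂) ℝ → ℝ)
    (X₀ : Matrix (Fin n₁) (Fin n₂) ℝ) : Set (Matrix (Fin n₁) (Fin n₂) ℝ) :=
  {Y | ∀ X, frobInner Y (X - X₀) ≤ g X - g X₀}

/-- The adjoint `Φ*` with respect to the Frobenius inner product on matrices and the standard
inner product on `ℝᵐ`; see `frobInner_frobAdjoint`. -/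
def frobAdjoint {n₁ n₂ m : ℕ}
    (Φ : Matrix (Fin n₁) (Fin n₂) ℝ →ₗ[ℝ] EuclideanSpace ℝ (Fin m))
    (z : EuclideanSpace ℝ (Fin m)) : Matrix (Fin n₁) (Fin n₂) ℝ :=
  Matrix.of fun i j => inner ℝ z (Φ (Matrix.single i j 1))

theorem frobInner_frobAdjoint {n₁ n₂ m : ℕ}
    (Φ : Matrix (Fin n₁) (Fin n₂) ℝ →ₗ[ℝ] EuclideanSpace ℝ (Fin m))
    (z : EuclideanSpace ℝ (Fin m)) (X : Matrix (Fin n₁) (Fin n₂) ℝ) :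
    frobInner (frobAdjoint Φ z) X = inner ℝ z (Φ X) := by
  have hX : Φ X = ∑ i, ∑ j, X i j • Φ (Matrix.single i j 1) := by
    conv_lhs => rw [Matrix.matrix_eq_sum_single X]
    simp only [map_sum]
    refine Finset.sum_congr rfl fun i _ => Finset.sum_congr rfl fun j _ => ?_
    rw [← map_smul, Matrix.smul_single, smul_eq_mul, mul_one]
  rw [hX]
  simp only [inner_sum, inner_smul_right, frobInner, Matrix.trace, Matrix.diag_apply,
    Matrix.mul_apply, Matrix.transpose_apply, frobAdjoint, Matrix.of_apply]
  rw [Finset.sum_comm]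
  exact Finset.sum_congr rfl fun i _ => Finset.sum_congr rfl fun j _ => mul_comm _ _

/-- `X₀` is an optimal solution of: minimize `‖X‖_*` subject to `Φ X = M₀`. -/
def IsOptimalSolution {n₁ n₂ m : ℕ}
    (Φ : Matrix (Fin n₁) (Fin n₂) ℝ →ₗ[ℝ] EuclideanSpace ℝ (Fin m))
    (M₀ : EuclideanSpace ℝ (Fin m)) (X₀ : Matrix (Fin n₁) (Fin n₂) ℝ) : Prop :=
  Φ X₀ = M₀ ∧ ∀ X, Φ X = M₀ → nuclearNorm X₀ ≤ nuclearNorm X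

/-- The set `∂‖X₀‖_* ∩ Im Φ*` of dual certificates. -/
def dualCertificates {n₁ n₂ m : ℕ}
    (Φ : Matrix (Fin n₁) (Fin n₂) ℝ →ₗ[ℝ] EuclideanSpace ℝ (Fin m))
    (X₀ : Matrix (Fin n₁) (Fin n₂) ℝ) : Set (Matrix (Fin n₁) (Fin n₂) ℝ) :=
  subdifferential nuclearNorm X₀ ∩ Set.range (frobAdjoint Φ)

end

/-! The nuclear norm has two dual descriptions: `‖X‖_*` is the largest value of `⟨U [I 0] Vᵀ, X⟩`
over orthogonal `U`, `V`, and the smallest value of `(Tr PᵀP + Tr QᵀQ) / 2` over factorizations `X =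
P Qᵀ`. Both come from `trace_add_trace_sub_frobInner`, which writes the gap between the two sides as
a sum of nonnegative terms. When the gap is zero (`exists_padBlock_of_frobInner_eq`), `UᵀP` and
`VᵀQ` agree in the rows with `s i = 1` and vanish in all others, so `X` is a positive semidefinite
block in the bases `U`, `V`. Thus the matrices on which a functional attains the nuclear norm form a
copy of a positive semidefinite cone.

Let `W = t (X - X₀)` be a descent direction with `t > 0`. If the norm drops strictly at the midpoint
of `X` and `X₀`, then `W` is interior to the critical cone. Otherwise a functional `U [I 0] Vᵀ`
attaining the norm at the midpoint attains it at both ends. The bases can be rotated to an SVD of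
`X₀` without changing this functional, and `W` becomes a multiple of a positive semidefinite block
minus `Diag(σ, 0)`. Positivity forces the off-diagonal block to have the form `B C`
(`exists_mul_gram_eq`).

Conversely, for such a block matrix the Schur complement keeps `X₀ + t W` positive semidefinite for
small `t > 0`, and the trace condition keeps the norm from growing. An interior critical direction
`W` is a descent direction because `W + ε X₀` is still critical and the resulting slack is removed
by rescaling.

For the constrained problem, a dual certificate `Y` is orthogonal to `Ker Φ`. It therefore attains
the norm at both `X` and `X₀`, and the equality case applies with `s = σ(Y)`. -/

noncomputable section

/-! ### Rectangular diagonal matrices and singular values -/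

/-- The rectangular diagonal matrix with diagonal entries `τ 0, τ 1, …`. -/
def rectDiag (n₁ n₂ : ℕ) (τ : ℕ → ℝ) : Matrix (Fin n₁) (Fin n₂) ℝ :=
  Matrix.of fun i j => if (i : ℕ) = (j : ℕ) then τ i else 0

theorem diagSigma_eq_rectDiag {n₁ n₂ : ℕ} (X : Matrix (Fin n₁) (Fin n₂) ℝ) :
    diagSigma X = rectDiag n₁ n₂ (sigma X) := rfl

theorem sigma_nonneg {n₁ n₂ : ℕ} (X : Matrix (Fin n₁) (Fin n₂) ℝ) (i : ℕ) : 0 ≤ sigma X i :=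
  LinearMap.singularValues_nonneg _ i

theorem sigma_antitone {n₁ n₂ : ℕ} (X : Matrix (Fin n₁) (Fin n₂) ℝ) : Antitone (sigma X) :=
  LinearMap.singularValues_antitone _

theorem sigma_pos_iff {n₁ n₂ : ℕ} (X : Matrix (Fin n₁) (Fin n₂) ℝ) (i : ℕ) :
    0 < sigma X i ↔ i < X.rank := by
  rw [sigma, LinearMap.singularValues_pos_iff_lt_finrank_range,
    Matrix.toEuclideanLin_eq_toLin_orthonormal, ← Matrix.rank_eq_finrank_range_toLin]

theorem rank_le_of_fin {n₁ n₂ : ℕ} (X : Matrix (Fin n₁) (Fin n₂) ℝ) : X.rank ≤ n₁ := by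
  simpa using X.rank_le_card_height

theorem sigma_eq_zero_of_le {n₁ n₂ : ℕ} (X : Matrix (Fin n₁) (Fin n₂) ℝ) {i : ℕ} (hi : n₁ ≤ i) :
    sigma X i = 0 := by
  refine le_antisymm (not_lt.1 fun h => ?_) (sigma_nonneg X i)
  have := (sigma_pos_iff X i).1 h
  have := rank_le_of_fin X
  omega

/-- The matrix whose columns form an orthonormal basis. -/
def basisMatrix {n : ℕ} (b : OrthonormalBasis (Fin n) ℝ (EuclideanSpace ℝ (Fin n))) :
    Matrix (Fin n) (Fin n) ℝ :=
  Matrix.of fun i j => b j i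

theorem basisMatrix_mem_orthogonalGroup {n : ℕ}
    (b : OrthonormalBasis (Fin n) ℝ (EuclideanSpace ℝ (Fin n))) :
    basisMatrix b ∈ Matrix.orthogonalGroup (Fin n) ℝ := by
  rw [Matrix.mem_orthogonalGroup_iff']
  ext i j
  have h := orthonormal_iff_ite.1 b.orthonormal i j
  rw [PiLp.inner_apply] at h
  simp only [RCLike.inner_apply, conj_trivial] at h
  rw [Matrix.mul_apply, Matrix.one_apply, ← h]
  exact Finset.sum_congr rfl fun k _ => by simp [basisMatrix, mul_comm]

theorem eq_mul_of_mul_eq_orthogonal {m n : ℕ} {X M : Matrix (Fin m) (Fin n) ℝ}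
    {V : Matrix (Fin n) (Fin n) ℝ} (hV : V ∈ Matrix.orthogonalGroup (Fin n) ℝ)
    (h : X * V = M) : X = M * Vᵀ := by
  rw [← h, Matrix.mul_assoc, (Matrix.mem_orthogonalGroup_iff _ _).1 hV, Matrix.mul_one]

theorem mul_basisMatrix_apply {m n : ℕ} (X : Matrix (Fin m) (Fin n) ℝ)
    (b : OrthonormalBasis (Fin n) ℝ (EuclideanSpace ℝ (Fin n))) (i : Fin m) (j : Fin n) :
    (X * basisMatrix b) i j = Matrix.toEuclideanLin X (b j) i := by
  rw [Matrix.toLpLin_apply, Matrix.mul_apply]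
  rfl

/-- Every matrix has a singular value decomposition. -/
theorem svdPairs_nonempty {n₁ n₂ : ℕ} (X : Matrix (Fin n₁) (Fin n₂) ℝ) : (svdPairs X).Nonempty := by
  set T := Matrix.toEuclideanLin X with hTdef
  have hn : Module.finrank ℝ (EuclideanSpace ℝ (Fin n₂)) = n₂ := by simp
  have hT := T.isSymmetric_adjoint_comp_self
  set v := hT.eigenvectorBasis hn
  have hinner : ∀ i j, inner ℝ (T (v i)) (T (v j)) = if i = j then sigma X i ^ 2 else 0 := by
    intro i j
    rw [← LinearMap.adjoint_inner_left, ← LinearMap.comp_apply, hT.apply_eigenvectorBasis hn,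
      inner_smul_left, orthonormal_iff_ite.1 v.orthonormal]
    simp only [sigma]
    rw [← hTdef, T.sq_singularValues_fin hn i]
    split_ifs <;> simp
  -- Left singular vectors `T vᵢ / σᵢ`. Only those with `σᵢ > 0` are kept when completing to an
  -- orthonormal basis, and `hlt` shows that the default value `0` is not among them.
  let u : Fin n₁ → EuclideanSpace ℝ (Fin n₁) := fun i =>
    if h : (i : ℕ) < n₂ then (sigma X i)⁻¹ • T (v ⟨i, h⟩) else 0
  have hlt : ∀ i : ℕ, 0 < sigma X i → i < n₂ := by
    intro i hi
    have := (sigma_pos_iff X i).1 hi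
    have := X.rank_le_card_width
    simp at this
    omega
  have hu : Orthonormal ℝ (Set.domRestrict {i : Fin n₁ | 0 < sigma X i} u) := by
    rw [orthonormal_iff_ite]
    rintro ⟨i, hi⟩ ⟨j, hj⟩
    simp only [Set.mem_ofPred_eq] at hi hj
    simp only [Set.domRestrict_apply, u, hlt i hi, hlt j hj, dif_pos, inner_smul_left,
      inner_smul_right, hinner, conj_trivial, Fin.mk.injEq, Subtype.mk.injEq, Fin.val_inj]
    split_ifs with h
    · subst h
      field_simp
    · simp
  obtain ⟨b, hb⟩ := hu.exists_orthonormalBasis_extension_of_card_eq (by simp)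
  refine ⟨(basisMatrix b, basisMatrix v), basisMatrix_mem_orthogonalGroup b,
    basisMatrix_mem_orthogonalGroup v,
    eq_mul_of_mul_eq_orthogonal (basisMatrix_mem_orthogonalGroup v) ?_⟩
  ext i j
  rw [mul_basisMatrix_apply, ← hTdef, Matrix.mul_apply]
  simp only [diagSigma, Matrix.of_apply, mul_ite, mul_zero, basisMatrix]
  by_cases hj : 0 < sigma X j
  · have hj1 : (j : ℕ) < n₁ := by
      by_contra h
      rw [sigma_eq_zero_of_le X (not_lt.1 h)] at hj
      exact lt_irrefl _ hj
    rw [Finset.sum_eq_single ⟨j, hj1⟩]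
    · rw [hb ⟨j, hj1⟩ hj]
      simp [u]
      field_simp
    · intro k _ hk
      rw [if_neg]
      intro h
      exact hk (Fin.ext h)
    · simp
  · have h0 : sigma X j = 0 := le_antisymm (not_lt.1 hj) (sigma_nonneg X j)
    have hv : T (v j) = 0 := by
      rw [← inner_self_eq_zero (𝕜 := ℝ), hinner, if_pos rfl, h0]
      simp
    rw [hv]
    symm
    refine (Finset.sum_eq_zero fun k _ => ?_)
    split_ifs with h
    · rw [h, h0, mul_zero]
    · rfl

/-- Spectral decomposition of a positive semidefinite matrix with decreasing eigenvalues. -/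
theorem exists_sorted_spectral {n : ℕ} {S : Matrix (Fin n) (Fin n) ℝ} (hS : S.PosSemidef) :
    ∃ Q ∈ Matrix.orthogonalGroup (Fin n) ℝ, ∃ d : Fin n → ℝ, Antitone d ∧ (∀ i, 0 ≤ d i) ∧
      S = Q * Matrix.diagonal d * Qᵀ := by
  have hT : (Matrix.toEuclideanLin S).IsSymmetric :=
    Matrix.isSymmetric_toEuclideanLin_iff.2 hS.isHermitian
  have hn : Module.finrank ℝ (EuclideanSpace ℝ (Fin n)) = n := by simp
  have hS' : S = basisMatrix (hT.eigenvectorBasis hn) * Matrix.diagonal (hT.eigenvalues hn) *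
      (basisMatrix (hT.eigenvectorBasis hn))ᵀ := by
    refine eq_mul_of_mul_eq_orthogonal (basisMatrix_mem_orthogonalGroup _) ?_
    ext i j
    rw [mul_basisMatrix_apply, hT.apply_eigenvectorBasis hn]
    simp [basisMatrix, mul_comm]
  refine ⟨basisMatrix (hT.eigenvectorBasis hn), basisMatrix_mem_orthogonalGroup _,
    hT.eigenvalues hn, hT.eigenvalues_antitone hn, fun i => ?_, hS'⟩
  exact (Matrix.isPositive_toEuclideanLin_iff.2 hS).nonneg_eigenvalues hn i

theorem exists_eq_mul_transpose_of_posSemidef {ι : Type*} [Fintype ι] {S : Matrix ι ι ℝ}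
    (hS : S.PosSemidef) : ∃ (n : ℕ) (R : Matrix ι (Fin n) ℝ), S = R * Rᵀ := by
  obtain ⟨n, A, rfl⟩ := Matrix.posSemidef_iff_eq_sum_vecMulVec.1 hS
  refine ⟨n, Matrix.of fun i k => A k i, ?_⟩
  ext i j
  simp [Matrix.sum_apply, Matrix.vecMulVec_apply, Matrix.mul_apply]

/-- The ordered eigenvalues are the sorted roots of the characteristic polynomial, and an antitone
list is already sorted. -/
theorem eigenvalues_eq_of_charpoly {n : ℕ} {M : Matrix (Fin n) (Fin n) ℝ}
    (hT : (Matrix.toEuclideanLin M).IsSymmetric)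
    (hn : Module.finrank ℝ (EuclideanSpace ℝ (Fin n)) = n) {d : Fin n → ℝ} (hd : Antitone d)
    (h : M.charpoly = (Matrix.diagonal d).charpoly) : hT.eigenvalues hn = d := by
  have hc : (Matrix.toEuclideanLin M).charpoly = M.charpoly := by
    rw [Matrix.toEuclideanLin_eq_toLin_orthonormal, Matrix.charpoly_toLin]
  rw [← List.ofFn_inj, ← hT.sort_roots_charpoly_eq_eigenvalues, hc, h, Matrix.charpoly_diagonal,
    Polynomial.roots_prod _ _ (by simp [Finset.prod_ne_zero_iff, Polynomial.X_sub_C_ne_zero])]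
  simp only [Polynomial.roots_X_sub_C, Multiset.bind_singleton, Fin.univ_val_map,
    RCLike.re_to_real, Multiset.map_id', Multiset.coe_sort]
  refine List.mergeSort_of_pairwise ?_
  simp_rw [decide_eq_true_eq, ← List.sortedGE_iff_pairwise]
  exact hd.sortedGE_ofFn

theorem charpoly_orthogonal_conj {n : ℕ} {V : Matrix (Fin n) (Fin n) ℝ}
    (hV : V ∈ Matrix.orthogonalGroup (Fin n) ℝ) (N : Matrix (Fin n) (Fin n) ℝ) :
    (V * N * Vᵀ).charpoly = N.charpoly := by
  rw [Matrix.charpoly_mul_comm, ← Matrix.mul_assoc, (Matrix.mem_orthogonalGroup_iff' _ _).1 hV,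
    Matrix.one_mul]

theorem rectDiag_transpose_mul_self {n₁ n₂ : ℕ} {τ : ℕ → ℝ} (h0 : ∀ i, n₁ ≤ i → τ i = 0) :
    (rectDiag n₁ n₂ τ)ᵀ * rectDiag n₁ n₂ τ = Matrix.diagonal fun j : Fin n₂ => τ j ^ 2 := by
  ext i j
  rw [Matrix.mul_apply, Matrix.diagonal_apply]
  simp only [rectDiag, Matrix.transpose_apply, Matrix.of_apply, ite_mul, zero_mul, mul_ite,
    mul_zero]
  by_cases hj : (j : ℕ) < n₁
  · rw [Finset.sum_eq_single ⟨j, hj⟩]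
    · by_cases h : i = j
      · simp [h, sq]
      · simp [h, Fin.ext_iff.not.1 (Ne.symm h)]
    · intro k _ hk
      rw [if_neg]
      intro h
      exact hk (Fin.ext h)
    · simp
  · rw [Finset.sum_eq_zero]
    · split_ifs with h
      · rw [h, h0 j (not_lt.1 hj)]
        simp
      · rfl
    · intro k _
      rw [if_neg]
      intro h
      omega

/-- The singular values are determined by any ordered decomposition. -/
theorem sigma_eq_of_eq_mul {n₁ n₂ : ℕ} {X : Matrix (Fin n₁) (Fin n₂) ℝ}
    {U : Matrix (Fin n₁) (Fin n₁) ℝ} {V : Matrix (Fin n₂) (Fin n₂) ℝ} {τ : ℕ → ℝ}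
    (hU : U ∈ Matrix.orthogonalGroup (Fin n₁) ℝ) (hV : V ∈ Matrix.orthogonalGroup (Fin n₂) ℝ)
    (hτ : Antitone τ) (hpos : ∀ i, 0 ≤ τ i) (h0 : ∀ i, n₁ ≤ i → τ i = 0)
    (hX : X = U * rectDiag n₁ n₂ τ * Vᵀ) (j : Fin n₂) : sigma X j = τ j := by
  set T := Matrix.toEuclideanLin X with hTdef
  have hn : Module.finrank ℝ (EuclideanSpace ℝ (Fin n₂)) = n₂ := by simp
  have hT := T.isSymmetric_adjoint_comp_self
  have hcomp : LinearMap.adjoint T ∘ₗ T = Matrix.toEuclideanLin (Xᵀ * X) := by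
    rw [hTdef, ← Matrix.toEuclideanLin_conjTranspose_eq_adjoint,
      Matrix.conjTranspose_eq_transpose_of_trivial]
    exact (Matrix.toLpLin_mul_same _ _ _).symm
  -- The factor `U` cancels in `XᵀX`, so the ordered squares `τ j ^ 2` are its eigenvalues and hence
  -- the squared singular values.
  have hXX : Xᵀ * X = V * Matrix.diagonal (fun j : Fin n₂ => τ j ^ 2) * Vᵀ := by
    rw [← rectDiag_transpose_mul_self h0, hX]
    simp only [Matrix.transpose_mul, Matrix.transpose_transpose, Matrix.mul_assoc]
    rw [← Matrix.mul_assoc Uᵀ U, (Matrix.mem_orthogonalGroup_iff' _ _).1 hU, Matrix.one_mul]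
  have hT2 : (Matrix.toEuclideanLin (Xᵀ * X)).IsSymmetric := hcomp ▸ hT
  have he : hT.eigenvalues hn = hT2.eigenvalues hn := by
    rw [LinearMap.IsSymmetric.eigenvalues_eq_eigenvalues_iff, hcomp]
  have hd : hT2.eigenvalues hn = fun j : Fin n₂ => τ j ^ 2 := by
    refine eigenvalues_eq_of_charpoly hT2 hn (fun i k hik => ?_) ?_
    · exact pow_le_pow_left₀ (hpos _) (hτ hik) 2
    · rw [hXX, charpoly_orthogonal_conj hV]
  have := T.sq_singularValues_fin hn j
  rw [he, hd] at this
  exact (sq_eq_sq₀ (T.singularValues_nonneg _) (hpos _)).1 this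

/-! ### Variational description of the nuclear norm -/

theorem trace_transpose_mul_self {m k : Type*} [Fintype m] [Fintype k] (P : Matrix m k ℝ) :
    (Pᵀ * P).trace = ∑ i, ∑ l, P i l ^ 2 := by
  simp only [Matrix.trace, Matrix.diag_apply, Matrix.mul_apply, Matrix.transpose_apply]
  rw [Finset.sum_comm]
  simp only [sq]

theorem trace_orthogonal_mul {n : ℕ} {k : Type*} [Fintype k] {U : Matrix (Fin n) (Fin n) ℝ}
    (hU : U ∈ Matrix.orthogonalGroup (Fin n) ℝ) (P : Matrix (Fin n) k ℝ) :
    ((U * P)ᵀ * (U * P)).trace = (Pᵀ * P).trace := by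
  rw [Matrix.transpose_mul, Matrix.mul_assoc, ← Matrix.mul_assoc Uᵀ,
    (Matrix.mem_orthogonalGroup_iff' _ _).1 hU, Matrix.one_mul]

theorem transpose_mem_orthogonalGroup {n : ℕ} {U : Matrix (Fin n) (Fin n) ℝ}
    (hU : U ∈ Matrix.orthogonalGroup (Fin n) ℝ) : Uᵀ ∈ Matrix.orthogonalGroup (Fin n) ℝ := by
  rw [Matrix.mem_orthogonalGroup_iff, Matrix.transpose_transpose]
  exact (Matrix.mem_orthogonalGroup_iff' _ _).1 hU

theorem frobInner_add_right {n₁ n₂ : ℕ} (Y X X' : Matrix (Fin n₁) (Fin n₂) ℝ) :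
    frobInner Y (X + X') = frobInner Y X + frobInner Y X' := by
  simp [frobInner, Matrix.mul_add]

theorem frobInner_sub_right {n₁ n₂ : ℕ} (Y X X' : Matrix (Fin n₁) (Fin n₂) ℝ) :
    frobInner Y (X - X') = frobInner Y X - frobInner Y X' := by
  simp [frobInner, Matrix.mul_sub]

theorem frobInner_smul_right {n₁ n₂ : ℕ} (Y X : Matrix (Fin n₁) (Fin n₂) ℝ) (t : ℝ) :
    frobInner Y (t • X) = t * frobInner Y X := by
  simp [frobInner]

theorem frobInner_conj_mul {n₁ n₂ : ℕ} {k : Type*} [Fintype k]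
    (U : Matrix (Fin n₁) (Fin n₁) ℝ) (V : Matrix (Fin n₂) (Fin n₂) ℝ)
    (D : Matrix (Fin n₁) (Fin n₂) ℝ) (P : Matrix (Fin n₁) k ℝ) (Q : Matrix (Fin n₂) k ℝ) :
    frobInner (U * D * Vᵀ) (P * Qᵀ) = frobInner D ((Uᵀ * P) * (Vᵀ * Q)ᵀ) := by
  simp only [frobInner, Matrix.transpose_mul, Matrix.transpose_transpose, Matrix.mul_assoc]
  rw [Matrix.trace_mul_comm]
  simp only [Matrix.mul_assoc]

theorem frobInner_rectDiag_mul {n₁ n : ℕ} {k : Type*} [Fintype k] (s : ℕ → ℝ)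
    (P : Matrix (Fin n₁) k ℝ) (Q : Matrix (Fin (n₁ + n)) k ℝ) :
    frobInner (rectDiag n₁ (n₁ + n) s) (P * Qᵀ) =
      ∑ i : Fin n₁, ∑ l, s i * (P i l * Q (Fin.castAdd n i) l) := by
  simp only [frobInner, Matrix.trace, Matrix.diag_apply]
  rw [Fin.sum_univ_add]
  have h2 : ∀ i : Fin n, ((rectDiag n₁ (n₁ + n) s)ᵀ * (P * Qᵀ)) (Fin.natAdd n₁ i)
      (Fin.natAdd n₁ i) = 0 := by
    intro i
    rw [Matrix.mul_apply]
    refine Finset.sum_eq_zero fun l _ => ?_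
    have : (l : ℕ) ≠ n₁ + i := by omega
    simp [rectDiag, this]
  rw [Finset.sum_eq_zero fun i _ => h2 i, add_zero]
  refine Finset.sum_congr rfl fun i _ => ?_
  rw [Matrix.mul_apply, Finset.sum_eq_single i]
  · simp [rectDiag, Matrix.mul_apply, Finset.mul_sum]
  · intro l _ hl
    simp [rectDiag, Fin.val_inj, hl]
  · simp

/-- The defect in the inequality `2 ⟨rectDiag s, P Qᵀ⟩ ≤ Tr PᵀP + Tr QᵀQ` as a sum of
nonnegative terms. -/
theorem trace_add_trace_sub_frobInner {n₁ n : ℕ} {k : Type*} [Fintype k] (s : ℕ → ℝ)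
    (P : Matrix (Fin n₁) k ℝ) (Q : Matrix (Fin (n₁ + n)) k ℝ) :
    (Pᵀ * P).trace + (Qᵀ * Q).trace - 2 * frobInner (rectDiag n₁ (n₁ + n) s) (P * Qᵀ) =
      (∑ i : Fin n₁, ∑ l, ((1 - s i) * (P i l ^ 2 + Q (Fin.castAdd n i) l ^ 2) +
        s i * (P i l - Q (Fin.castAdd n i) l) ^ 2)) + ∑ j, ∑ l, Q (Fin.natAdd n₁ j) l ^ 2 := by
  rw [trace_transpose_mul_self, trace_transpose_mul_self, frobInner_rectDiag_mul,
    Fin.sum_univ_add (fun j => ∑ l, Q j l ^ 2), Finset.mul_sum, ← add_assoc, add_sub_right_comm,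
    ← Finset.sum_add_distrib, ← Finset.sum_sub_distrib]
  congr 1
  refine Finset.sum_congr rfl fun i _ => ?_
  rw [Finset.mul_sum, ← Finset.sum_add_distrib, ← Finset.sum_sub_distrib]
  exact Finset.sum_congr rfl fun l _ => by ring

/-- Weak duality: after moving the orthogonal factors onto `P` and `Q`, every term of the defect is
nonnegative because `0 ≤ s i ≤ 1`. -/
theorem two_mul_frobInner_le {n₁ n₂ : ℕ} {k : Type*} [Fintype k] (hn : n₁ ≤ n₂)
    {U : Matrix (Fin n₁) (Fin n₁) ℝ} {V : Matrix (Fin n₂) (Fin n₂) ℝ}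
    (hU : U ∈ Matrix.orthogonalGroup (Fin n₁) ℝ) (hV : V ∈ Matrix.orthogonalGroup (Fin n₂) ℝ)
    {s : ℕ → ℝ} (h0 : ∀ i, 0 ≤ s i) (h1 : ∀ i, s i ≤ 1)
    (P : Matrix (Fin n₁) k ℝ) (Q : Matrix (Fin n₂) k ℝ) :
    2 * frobInner (U * rectDiag n₁ n₂ s * Vᵀ) (P * Qᵀ) ≤ (Pᵀ * P).trace + (Qᵀ * Q).trace := by
  obtain ⟨n, rfl⟩ := Nat.exists_eq_add_of_le hn
  have h := trace_add_trace_sub_frobInner s (Uᵀ * P) (Vᵀ * Q)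
  rw [trace_orthogonal_mul (transpose_mem_orthogonalGroup hU),
    trace_orthogonal_mul (transpose_mem_orthogonalGroup hV), ← frobInner_conj_mul] at h
  rw [← sub_nonneg, h]
  refine add_nonneg (Finset.sum_nonneg fun i _ => Finset.sum_nonneg fun l _ => ?_)
    (Finset.sum_nonneg fun i _ => Finset.sum_nonneg fun l _ => sq_nonneg _)
  have := h0 i
  have := sub_nonneg.2 (h1 i)
  positivity

/-- The nuclear norm is attained by a factorization `X = P Qᵀ`. -/
theorem exists_factorization {n₁ n₂ : ℕ} (hn : n₁ ≤ n₂) (X : Matrix (Fin n₁) (Fin n₂) ℝ) :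
    ∃ (P : Matrix (Fin n₁) (Fin n₁) ℝ) (Q : Matrix (Fin n₂) (Fin n₁) ℝ), X = P * Qᵀ ∧
      (Pᵀ * P).trace = nuclearNorm X ∧ (Qᵀ * Q).trace = nuclearNorm X := by
  obtain ⟨⟨U, V⟩, hU, hV, hX⟩ := svdPairs_nonempty X
  simp only at hU hV hX
  obtain ⟨n, rfl⟩ := Nat.exists_eq_add_of_le hn
  have hsq : ∀ i, √(sigma X i) ^ 2 = sigma X i := fun i => Real.sq_sqrt (sigma_nonneg X i)
  -- The singular values are shared equally between the factors `U √Σ` and `V √Σᵀ`.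
  refine ⟨U * rectDiag n₁ n₁ (fun i => √(sigma X i)),
    V * (rectDiag n₁ (n₁ + n) (fun i => √(sigma X i)))ᵀ, ?_, ?_, ?_⟩
  · conv_lhs => rw [hX]
    simp only [Matrix.transpose_mul, Matrix.transpose_transpose, Matrix.mul_assoc]
    rw [← Matrix.mul_assoc (rectDiag n₁ n₁ _)]
    congr 2
    ext i j
    rw [Matrix.mul_apply, Finset.sum_eq_single i]
    · by_cases h : (i : ℕ) = j
      · simp [diagSigma, rectDiag, h, ← sq, hsq]
      · simp [diagSigma, rectDiag, h]
    · intro l _ hl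
      simp [rectDiag, Fin.val_inj, Ne.symm hl]
    · simp
  · rw [trace_orthogonal_mul hU, trace_transpose_mul_self]
    refine Finset.sum_congr rfl fun i _ => ?_
    rw [Finset.sum_eq_single i]
    · simp [rectDiag, hsq]
    · intro l _ hl
      simp [rectDiag, Fin.val_inj, Ne.symm hl]
    · simp
  · rw [trace_orthogonal_mul hV, trace_transpose_mul_self, Finset.sum_comm]
    refine Finset.sum_congr rfl fun i _ => ?_
    rw [Finset.sum_eq_single (Fin.castAdd n i)]
    · simp [rectDiag, hsq]
    · intro l _ hl
      have : (i : ℕ) ≠ l := fun h => hl (Fin.ext (by simp [h]))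
      simp [rectDiag, this]
    · simp

theorem frobInner_le_nuclearNorm {n₁ n₂ : ℕ} (hn : n₁ ≤ n₂)
    {U : Matrix (Fin n₁) (Fin n₁) ℝ} {V : Matrix (Fin n₂) (Fin n₂) ℝ}
    (hU : U ∈ Matrix.orthogonalGroup (Fin n₁) ℝ) (hV : V ∈ Matrix.orthogonalGroup (Fin n₂) ℝ)
    {s : ℕ → ℝ} (h0 : ∀ i, 0 ≤ s i) (h1 : ∀ i, s i ≤ 1) (X : Matrix (Fin n₁) (Fin n₂) ℝ) :
    frobInner (U * rectDiag n₁ n₂ s * Vᵀ) X ≤ nuclearNorm X := by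
  obtain ⟨P, Q, hX, hP, hQ⟩ := exists_factorization hn X
  have h := two_mul_frobInner_le hn hU hV h0 h1 P Q
  rw [← hX, hP, hQ] at h
  linarith

theorem frobInner_rectDiag_rectDiag {n₁ n₂ : ℕ} (hn : n₁ ≤ n₂) (s τ : ℕ → ℝ) :
    frobInner (rectDiag n₁ n₂ s) (rectDiag n₁ n₂ τ) = ∑ i : Fin n₁, s i * τ i := by
  obtain ⟨n, rfl⟩ := Nat.exists_eq_add_of_le hn
  have : rectDiag n₁ (n₁ + n) τ =
      (1 : Matrix (Fin n₁) (Fin n₁) ℝ) * ((rectDiag n₁ (n₁ + n) τ)ᵀ)ᵀ := by simp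
  rw [this, frobInner_rectDiag_mul]
  refine Finset.sum_congr rfl fun i _ => ?_
  rw [Finset.sum_eq_single i]
  · simp [rectDiag]
  · intro l _ hl
    simp [Ne.symm hl]
  · simp

theorem frobInner_svd {n₁ n₂ : ℕ} (hn : n₁ ≤ n₂)
    {U : Matrix (Fin n₁) (Fin n₁) ℝ} {V : Matrix (Fin n₂) (Fin n₂) ℝ}
    (hU : U ∈ Matrix.orthogonalGroup (Fin n₁) ℝ) (hV : V ∈ Matrix.orthogonalGroup (Fin n₂) ℝ)
    (s τ : ℕ → ℝ) :
    frobInner (U * rectDiag n₁ n₂ s * Vᵀ) (U * rectDiag n₁ n₂ τ * Vᵀ) =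
      ∑ i : Fin n₁, s i * τ i := by
  have h : Uᵀ * (U * rectDiag n₁ n₂ τ) * (Vᵀ * V)ᵀ = rectDiag n₁ n₂ τ := by
    rw [← Matrix.mul_assoc, (Matrix.mem_orthogonalGroup_iff' _ _).1 hU,
      (Matrix.mem_orthogonalGroup_iff' _ _).1 hV]
    simp
  rw [frobInner_conj_mul, h, frobInner_rectDiag_rectDiag hn]

/-- The nuclear norm is attained by a matrix `U [I 0] Vᵀ`. -/
theorem exists_frobInner_eq_nuclearNorm {n₁ n₂ : ℕ} (hn : n₁ ≤ n₂)
    (X : Matrix (Fin n₁) (Fin n₂) ℝ) :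
    ∃ U ∈ Matrix.orthogonalGroup (Fin n₁) ℝ, ∃ V ∈ Matrix.orthogonalGroup (Fin n₂) ℝ,
      frobInner (U * rectDiag n₁ n₂ (fun _ => 1) * Vᵀ) X = nuclearNorm X := by
  obtain ⟨⟨U, V⟩, hU, hV, hX⟩ := svdPairs_nonempty X
  simp only at hU hV hX
  refine ⟨U, hU, V, hV, ?_⟩
  conv_lhs => rw [hX, diagSigma_eq_rectDiag, frobInner_svd hn hU hV]
  simp [nuclearNorm]

theorem nuclearNorm_mul_transpose_le {n₁ n₂ : ℕ} {k : Type*} [Fintype k] (hn : n₁ ≤ n₂)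
    (P : Matrix (Fin n₁) k ℝ) (Q : Matrix (Fin n₂) k ℝ) :
    2 * nuclearNorm (P * Qᵀ) ≤ (Pᵀ * P).trace + (Qᵀ * Q).trace := by
  obtain ⟨U, hU, V, hV, h⟩ := exists_frobInner_eq_nuclearNorm hn (P * Qᵀ)
  rw [← h]
  exact two_mul_frobInner_le hn hU hV (fun _ => zero_le_one) (fun _ => le_rfl) P Q

/-- A maximum of linear functionals is subadditive. -/
theorem nuclearNorm_add_le {n₁ n₂ : ℕ} (hn : n₁ ≤ n₂) (X X' : Matrix (Fin n₁) (Fin n₂) ℝ) :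
    nuclearNorm (X + X') ≤ nuclearNorm X + nuclearNorm X' := by
  obtain ⟨U, hU, V, hV, h⟩ := exists_frobInner_eq_nuclearNorm hn (X + X')
  rw [← h, frobInner_add_right]
  exact add_le_add
    (frobInner_le_nuclearNorm hn hU hV (fun _ => zero_le_one) (fun _ => le_rfl) X)
    (frobInner_le_nuclearNorm hn hU hV (fun _ => zero_le_one) (fun _ => le_rfl) X')

theorem nuclearNorm_nonneg {n₁ n₂ : ℕ} (X : Matrix (Fin n₁) (Fin n₂) ℝ) : 0 ≤ nuclearNorm X :=
  Finset.sum_nonneg fun i _ => sigma_nonneg X i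

theorem nuclearNorm_smul_le {n₁ n₂ : ℕ} (hn : n₁ ≤ n₂) {t : ℝ} (ht : 0 ≤ t)
    (X : Matrix (Fin n₁) (Fin n₂) ℝ) : nuclearNorm (t • X) ≤ t * nuclearNorm X := by
  obtain ⟨U, hU, V, hV, h⟩ := exists_frobInner_eq_nuclearNorm hn (t • X)
  rw [← h, frobInner_smul_right]
  exact mul_le_mul_of_nonneg_left
    (frobInner_le_nuclearNorm hn hU hV (fun _ => zero_le_one) (fun _ => le_rfl) X) ht

theorem nuclearNorm_zero {n₁ n₂ : ℕ} (hn : n₁ ≤ n₂) :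
    nuclearNorm (0 : Matrix (Fin n₁) (Fin n₂) ℝ) = 0 := by
  refine le_antisymm ?_ (nuclearNorm_nonneg _)
  simpa using nuclearNorm_smul_le hn le_rfl (0 : Matrix (Fin n₁) (Fin n₂) ℝ)

theorem nuclearNorm_smul {n₁ n₂ : ℕ} (hn : n₁ ≤ n₂) {t : ℝ} (ht : 0 ≤ t)
    (X : Matrix (Fin n₁) (Fin n₂) ℝ) : nuclearNorm (t • X) = t * nuclearNorm X := by
  refine le_antisymm (nuclearNorm_smul_le hn ht X) ?_
  rcases ht.eq_or_lt with rfl | ht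
  · simpa using nuclearNorm_nonneg _
  · have h := nuclearNorm_smul_le hn (inv_nonneg.2 ht.le) (t • X)
    rw [smul_smul, inv_mul_cancel₀ ht.ne', one_smul] at h
    rwa [← le_inv_mul_iff₀ ht]

theorem convexOn_nuclearNorm {n₁ n₂ : ℕ} (hn : n₁ ≤ n₂) :
    ConvexOn ℝ Set.univ (nuclearNorm : Matrix (Fin n₁) (Fin n₂) ℝ → ℝ) := by
  refine ⟨convex_univ, fun X _ X' _ a b ha hb _ => ?_⟩
  refine (nuclearNorm_add_le hn _ _).trans ?_
  rw [nuclearNorm_smul hn ha, nuclearNorm_smul hn hb, smul_eq_mul, smul_eq_mul]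

theorem continuous_nuclearNorm {n₁ n₂ : ℕ} (hn : n₁ ≤ n₂) :
    Continuous (nuclearNorm : Matrix (Fin n₁) (Fin n₂) ℝ → ℝ) :=
  continuousOn_univ.1 <| ConvexOn.continuousOn (E := Fin n₁ → Fin n₂ → ℝ) isOpen_univ
    (convexOn_nuclearNorm hn)

/-! ### Padding by zeros and the equality case -/

/-- The `0/1` matrix embedding `ℝʳ × ℝ^q` into the first coordinates of `ℝⁿ`. -/
def padCol (n r q : ℕ) : Matrix (Fin n) (Fin r ⊕ Fin q) ℝ :=
  Matrix.of fun i k => if (i : ℕ) = (finSumFinEquiv k : Fin (r + q)) then 1 else 0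

theorem padCol_mul_apply {n r q : ℕ} {κ : Type*} (M : Matrix (Fin r ⊕ Fin q) κ ℝ) (i : Fin n)
    (k : κ) : (padCol n r q * M) i k =
      if h : (i : ℕ) < r + q then M (finSumFinEquiv.symm ⟨i, h⟩) k else 0 := by
  rw [Matrix.mul_apply]
  split_ifs with h
  · rw [Finset.sum_eq_single (finSumFinEquiv.symm ⟨i, h⟩)]
    · simp [padCol]
    · intro l _ hl
      have : (i : ℕ) ≠ (finSumFinEquiv l : Fin (r + q)) := by
        intro h'
        apply hl
        rw [Equiv.eq_symm_apply]
        exact Fin.ext h'.symm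
      simp [padCol, this]
    · simp
  · refine Finset.sum_eq_zero fun l _ => ?_
    have : (i : ℕ) ≠ (finSumFinEquiv l : Fin (r + q)) := by
      have := (finSumFinEquiv l : Fin (r + q)).isLt
      omega
    simp [padCol, this]

theorem padBlock_eq (n₁ n₂ : ℕ) {r q : ℕ} (M : Matrix (Fin r ⊕ Fin q) (Fin r ⊕ Fin q) ℝ) :
    padBlock n₁ n₂ M = padCol n₁ r q * M * (padCol n₂ r q)ᵀ := by
  ext i j
  rw [Matrix.mul_assoc, padCol_mul_apply]
  have h : ∀ k, (M * (padCol n₂ r q)ᵀ) k j = (padCol n₂ r q * Mᵀ) j k := by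
    intro k
    rw [← Matrix.transpose_apply (M * _), Matrix.transpose_mul, Matrix.transpose_transpose]
  simp only [h, padCol_mul_apply, padBlock, Matrix.of_apply, Matrix.transpose_apply]
  split_ifs <;> first | rfl | omega

theorem padCol_transpose_mul_self {n r q : ℕ} (h : r + q ≤ n) :
    (padCol n r q)ᵀ * padCol n r q = 1 := by
  ext k l
  have hk := (finSumFinEquiv k : Fin (r + q)).isLt
  rw [Matrix.mul_apply, Finset.sum_eq_single ⟨finSumFinEquiv k, by omega⟩]
  · by_cases hkl : k = l
    · subst hkl
      simp [padCol]
    · have : (finSumFinEquiv k : Fin (r + q)).val ≠ (finSumFinEquiv l : Fin (r + q)) := by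
        rw [Ne, Fin.val_inj, finSumFinEquiv.injective.eq_iff]
        exact hkl
      simp [padCol, hkl, this]
  · intro i _ hi
    have : (i : ℕ) ≠ (finSumFinEquiv k : Fin (r + q)) := fun h => hi (Fin.ext h)
    simp [padCol, this]
  · simp

/-- If `⟨U (rectDiag s) Vᵀ, X⟩ = ‖X‖_*` with `0 ≤ s ≤ 1`, then in the bases `U`, `V` the matrix `X`
is positive semidefinite on the coordinates with `s i = 1` and zero elsewhere. -/
theorem exists_padBlock_of_frobInner_eq {n₁ n₂ r q : ℕ} (hn : n₁ ≤ n₂) (hp : r + q ≤ n₁)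
    {U : Matrix (Fin n₁) (Fin n₁) ℝ} {V : Matrix (Fin n₂) (Fin n₂) ℝ}
    (hU : U ∈ Matrix.orthogonalGroup (Fin n₁) ℝ) (hV : V ∈ Matrix.orthogonalGroup (Fin n₂) ℝ)
    {s : ℕ → ℝ} (h0 : ∀ i, 0 ≤ s i) (h1 : ∀ i, s i ≤ 1)
    (hs : ∀ i, i < n₁ → (s i = 1 ↔ i < r + q)) {X : Matrix (Fin n₁) (Fin n₂) ℝ}
    (hX : frobInner (U * rectDiag n₁ n₂ s * Vᵀ) X = nuclearNorm X) :
    ∃ S : Matrix (Fin r ⊕ Fin q) (Fin r ⊕ Fin q) ℝ, S.PosSemidef ∧ S.trace = nuclearNorm X ∧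
      X = U * padBlock n₁ n₂ S * Vᵀ := by
  obtain ⟨P, Q, hPQ, hP, hQ⟩ := exists_factorization hn X
  obtain ⟨n, rfl⟩ := Nat.exists_eq_add_of_le hn
  set P' := Uᵀ * P with hP'
  set Q' := Vᵀ * Q with hQ'
  have hPt : (P'ᵀ * P').trace = nuclearNorm X := by
    rw [trace_orthogonal_mul (transpose_mem_orthogonalGroup hU), hP]
  have h := trace_add_trace_sub_frobInner s P' Q'
  rw [hPt, trace_orthogonal_mul (transpose_mem_orthogonalGroup hV), ← frobInner_conj_mul,
    ← hPQ, hX, hQ] at h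
  have hnn1 : ∀ (i : Fin n₁) (l : Fin n₁),
      0 ≤ (1 - s i) * (P' i l ^ 2 + Q' (Fin.castAdd n i) l ^ 2) +
      s i * (P' i l - Q' (Fin.castAdd n i) l) ^ 2 := by
    intro i l
    have := h0 i
    have := sub_nonneg.2 (h1 i)
    positivity
  have hnn2 : ∀ (j : Fin n) (l : Fin n₁), 0 ≤ Q' (Fin.natAdd n₁ j) l ^ 2 := fun j l => sq_nonneg _
  have hz : nuclearNorm X + nuclearNorm X - 2 * nuclearNorm X = 0 := by ring
  rw [hz] at h
  -- An optimal factorization makes the total defect zero, so each of its terms vanishes.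
  have hsum := (add_eq_zero_iff_of_nonneg
    (Finset.sum_nonneg fun i _ => Finset.sum_nonneg fun l _ => hnn1 i l)
    (Finset.sum_nonneg fun i _ => Finset.sum_nonneg fun l _ => hnn2 i l)).1 h.symm
  have ht1 : ∀ (i : Fin n₁) (l : Fin n₁), (1 - s i) * (P' i l ^ 2 + Q' (Fin.castAdd n i) l ^ 2) +
      s i * (P' i l - Q' (Fin.castAdd n i) l) ^ 2 = 0 := by
    intro i l
    have := (Finset.sum_eq_zero_iff_of_nonneg
      (fun i _ => Finset.sum_nonneg fun l _ => hnn1 i l)).1 hsum.1 i (Finset.mem_univ _)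
    exact (Finset.sum_eq_zero_iff_of_nonneg (fun l _ => hnn1 i l)).1 this l (Finset.mem_univ _)
  have ht2 : ∀ (j : Fin n) (l : Fin n₁), Q' (Fin.natAdd n₁ j) l = 0 := by
    intro i l
    have := (Finset.sum_eq_zero_iff_of_nonneg
      (fun i _ => Finset.sum_nonneg fun l _ => hnn2 i l)).1 hsum.2 i (Finset.mem_univ _)
    exact pow_eq_zero_iff two_ne_zero |>.1 <|
      (Finset.sum_eq_zero_iff_of_nonneg (fun l _ => hnn2 i l)).1 this l (Finset.mem_univ _)
  have heq : ∀ (i : Fin n₁) (l : Fin n₁), (i : ℕ) < r + q → Q' (Fin.castAdd n i) l = P' i l := by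
    intro i l hi
    have h := ht1 i l
    rw [(hs i i.isLt).2 hi] at h
    have : (P' i l - Q' (Fin.castAdd n i) l) ^ 2 = 0 := by linarith
    have := pow_eq_zero_iff two_ne_zero |>.1 this
    linarith
  have hzero : ∀ (i : Fin n₁) (l : Fin n₁), ¬ (i : ℕ) < r + q →
      P' i l = 0 ∧ Q' (Fin.castAdd n i) l = 0 := by
    intro i l hi
    have h := ht1 i l
    have hlt : 0 < 1 - s i := sub_pos.2 (lt_of_le_of_ne (h1 i) fun h => hi ((hs i i.isLt).1 h))
    have ha : 0 ≤ s i * (P' i l - Q' (Fin.castAdd n i) l) ^ 2 := mul_nonneg (h0 i) (sq_nonneg _)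
    have hb : P' i l ^ 2 + Q' (Fin.castAdd n i) l ^ 2 ≤ 0 := by
      by_contra hc
      have := mul_pos hlt (not_le.1 hc)
      linarith
    have hb1 := sq_nonneg (P' i l)
    have hb2 := sq_nonneg (Q' (Fin.castAdd n i) l)
    exact ⟨pow_eq_zero_iff two_ne_zero |>.1 (by linarith),
      pow_eq_zero_iff two_ne_zero |>.1 (by linarith)⟩
  -- The rows shared by `P'` and `Q'`. All other rows of both are zero, so the block of `X` is the
  -- Gram matrix `R Rᵀ`.
  let R : Matrix (Fin r ⊕ Fin q) (Fin n₁) ℝ :=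
    Matrix.of fun k l => P' (Fin.castLE hp (finSumFinEquiv k)) l
  have hPR : P' = padCol n₁ r q * R := by
    ext i l
    rw [padCol_mul_apply]
    split_ifs with hi
    · simp [R]
    · exact (hzero i l hi).1
  have hQR : Q' = padCol (n₁ + n) r q * R := by
    ext j l
    rw [padCol_mul_apply]
    refine Fin.addCases (fun i => ?_) (fun i => ?_) j
    · split_ifs with hi
      · rw [heq i l hi]
        simp [R]
      · exact (hzero i l hi).2
    · rw [ht2, dif_neg]
      simp
      omega
  refine ⟨R * Rᵀ, ?_, ?_, ?_⟩
  · simpa using Matrix.posSemidef_self_mul_conjTranspose R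
  · rw [← hPt, hPR, Matrix.transpose_mul, Matrix.mul_assoc, ← Matrix.mul_assoc (padCol n₁ r q)ᵀ,
      padCol_transpose_mul_self hp, Matrix.one_mul, Matrix.trace_mul_comm]
  · have hPU : P = U * P' := by
      rw [hP', ← Matrix.mul_assoc, (Matrix.mem_orthogonalGroup_iff _ _).1 hU, Matrix.one_mul]
    have hQV : Q = V * Q' := by
      rw [hQ', ← Matrix.mul_assoc, (Matrix.mem_orthogonalGroup_iff _ _).1 hV, Matrix.one_mul]
    rw [hPQ, hPU, hQV, hPR, hQR, padBlock_eq]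
    simp only [Matrix.transpose_mul, Matrix.mul_assoc]

/-- Writing `S = R Rᵀ` gives a factorization of the padded matrix whose two factors both have
squared Frobenius norm `Tr S`. -/
theorem nuclearNorm_padBlock_le {n₁ n₂ r q : ℕ} (hn : n₁ ≤ n₂) (hp : r + q ≤ n₁)
    {U : Matrix (Fin n₁) (Fin n₁) ℝ} {V : Matrix (Fin n₂) (Fin n₂) ℝ}
    (hU : U ∈ Matrix.orthogonalGroup (Fin n₁) ℝ) (hV : V ∈ Matrix.orthogonalGroup (Fin n₂) ℝ)
    {S : Matrix (Fin r ⊕ Fin q) (Fin r ⊕ Fin q) ℝ} (hS : S.PosSemidef) :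
    nuclearNorm (U * padBlock n₁ n₂ S * Vᵀ) ≤ S.trace := by
  obtain ⟨k, R, rfl⟩ := exists_eq_mul_transpose_of_posSemidef hS
  have h := nuclearNorm_mul_transpose_le hn (U * (padCol n₁ r q * R)) (V * (padCol n₂ r q * R))
  have htr : ∀ n, r + q ≤ n →
      ((padCol n r q * R)ᵀ * (padCol n r q * R)).trace = (R * Rᵀ).trace := by
    intro n hn
    rw [Matrix.transpose_mul, Matrix.mul_assoc, ← Matrix.mul_assoc (padCol n r q)ᵀ,
      padCol_transpose_mul_self hn, Matrix.one_mul, Matrix.trace_mul_comm]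
  rw [trace_orthogonal_mul hU, trace_orthogonal_mul hV, htr _ hp, htr _ (hp.trans hn)] at h
  have he : U * padBlock n₁ n₂ (R * Rᵀ) * Vᵀ =
      U * (padCol n₁ r q * R) * (V * (padCol n₂ r q * R))ᵀ := by
    rw [padBlock_eq]
    simp only [Matrix.transpose_mul, Matrix.mul_assoc]
  rw [he]
  linarith

theorem padBlock_add_smul {n₁ n₂ r q : ℕ} (M M' : Matrix (Fin r ⊕ Fin q) (Fin r ⊕ Fin q) ℝ)
    (t : ℝ) : padBlock n₁ n₂ (M + t • M') = padBlock n₁ n₂ M + t • padBlock n₁ n₂ M' := by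
  simp only [padBlock_eq, Matrix.mul_add, Matrix.add_mul, Matrix.mul_smul, Matrix.smul_mul]

theorem trace_fromBlocks_sum {m n : Type*} [Fintype m] [Fintype n] (A : Matrix m m ℝ)
    (B : Matrix m n ℝ) (C : Matrix n m ℝ) (D : Matrix n n ℝ) :
    (Matrix.fromBlocks A B C D).trace = A.trace + D.trace := by
  simp [Matrix.trace, Fintype.sum_sum_type]

/-- The positive singular values of `X` as a block matrix. -/
def sigmaBlock {n₁ n₂ : ℕ} (X : Matrix (Fin n₁) (Fin n₂) ℝ) (r q : ℕ) :
    Matrix (Fin r ⊕ Fin q) (Fin r ⊕ Fin q) ℝ :=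
  Matrix.fromBlocks (Matrix.diagonal fun i : Fin r => sigma X i) 0 0 0

theorem diagSigma_eq_padBlock {n₁ n₂ : ℕ} (X : Matrix (Fin n₁) (Fin n₂) ℝ) (q : ℕ) :
    diagSigma X = padBlock n₁ n₂ (sigmaBlock X X.rank q) := by
  ext i j
  have hz : ∀ i, ¬ i < X.rank → sigma X i = 0 := fun i hi =>
    le_antisymm (not_lt.1 fun h => hi ((sigma_pos_iff X i).1 h)) (sigma_nonneg X i)
  simp only [diagSigma, padBlock, Matrix.of_apply]
  by_cases h : (i : ℕ) < X.rank + q ∧ (j : ℕ) < X.rank + q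
  · rw [dif_pos h]
    by_cases hi : (i : ℕ) < X.rank
    · have ei : finSumFinEquiv.symm (⟨i, h.1⟩ : Fin (X.rank + q)) = Sum.inl ⟨i, hi⟩ := by
        rw [Equiv.symm_apply_eq]
        rfl
      by_cases hj : (j : ℕ) < X.rank
      · have ej : finSumFinEquiv.symm (⟨j, h.2⟩ : Fin (X.rank + q)) = Sum.inl ⟨j, hj⟩ := by
          rw [Equiv.symm_apply_eq]
          rfl
        simp [ei, ej, sigmaBlock, Matrix.diagonal_apply]
      · have ej : finSumFinEquiv.symm (⟨j, h.2⟩ : Fin (X.rank + q)) =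
            Sum.inr ⟨j - X.rank, by omega⟩ := by
          rw [Equiv.symm_apply_eq]
          ext
          simp
          omega
        rw [ei, ej, if_neg (by omega)]
        rfl
    · have ei : finSumFinEquiv.symm (⟨i, h.1⟩ : Fin (X.rank + q)) =
          Sum.inr ⟨i - X.rank, by omega⟩ := by
        rw [Equiv.symm_apply_eq]
        ext
        simp
        omega
      rw [ei, hz i hi, ite_self]
      cases finSumFinEquiv.symm (⟨j, h.2⟩ : Fin (X.rank + q)) <;> rfl
  · rw [dif_neg h]
    split_ifs with hij
    · exact hz i (by omega)
    · rfl

theorem trace_sigmaBlock {n₁ n₂ : ℕ} (X : Matrix (Fin n₁) (Fin n₂) ℝ) (q : ℕ) :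
    (sigmaBlock X X.rank q).trace = nuclearNorm X := by
  have h : nuclearNorm X = ∑ i ∈ Finset.range n₁, sigma X i :=
    (Finset.sum_range (sigma X)).symm
  rw [sigmaBlock, trace_fromBlocks_sum, Matrix.trace_diagonal, Matrix.trace_zero, add_zero, h,
    ← Finset.sum_range (sigma X)]
  refine Finset.sum_subset (Finset.range_subset_range.2 (rank_le_of_fin X)) fun i _ hi => ?_
  refine le_antisymm (not_lt.1 fun h => hi ?_) (sigma_nonneg X i)
  exact Finset.mem_range.2 ((sigma_pos_iff X i).1 h)

/-! ### Positive semidefinite block matrices -/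

/-- The off-diagonal block `R₁ R₂ᵀ` of a Gram matrix factors through the diagonal block
`R₂ R₂ᵀ`. -/
theorem exists_mul_gram_eq {r q k : ℕ} (R₁ : Matrix (Fin r) (Fin k) ℝ)
    (R₂ : Matrix (Fin q) (Fin k) ℝ) :
    ∃ B : Matrix (Fin r) (Fin q) ℝ, R₁ * R₂ᵀ = B * (R₂ * R₂ᵀ) := by
  have hC : (R₂ * R₂ᵀ).PosSemidef := by
    simpa using Matrix.posSemidef_self_mul_conjTranspose R₂
  obtain ⟨Q, hQ, d, -, -, hd⟩ := exists_sorted_spectral hC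
  have hQ1 := (Matrix.mem_orthogonalGroup_iff' _ _).1 hQ
  have hQ2 := (Matrix.mem_orthogonalGroup_iff _ _).1 hQ
  have hN : (Qᵀ * R₂) * (Qᵀ * R₂)ᵀ = Matrix.diagonal d := by
    rw [Matrix.transpose_mul, Matrix.transpose_transpose, Matrix.mul_assoc, ← Matrix.mul_assoc R₂,
      hd]
    simp only [Matrix.mul_assoc]
    rw [hQ1, Matrix.mul_one, ← Matrix.mul_assoc, hQ1, Matrix.one_mul]
  have hrow : ∀ j, d j = 0 → ∀ l, (Qᵀ * R₂) j l = 0 := by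
    intro j hj l
    have h := congrFun (congrFun hN j) j
    rw [Matrix.diagonal_apply_eq, hj, Matrix.mul_apply] at h
    have := (Finset.sum_eq_zero_iff_of_nonneg (fun l _ => by
      rw [Matrix.transpose_apply]; exact mul_self_nonneg _)).1 h l (Finset.mem_univ _)
    rw [Matrix.transpose_apply] at this
    exact mul_self_eq_zero.1 this
  -- Since `0⁻¹ = 0`, the product `d⁻¹ d` is the projection onto the coordinates with `d j ≠ 0`. It
  -- changes nothing here, because the row `j` of `QᵀR₂` vanishes when `d j = 0`.
  have hfac : R₁ * (Qᵀ * R₂)ᵀ * (Matrix.diagonal (fun j => (d j)⁻¹) * Matrix.diagonal d) =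
      R₁ * (Qᵀ * R₂)ᵀ := by
    rw [Matrix.diagonal_mul_diagonal]
    ext i j
    rw [Matrix.mul_diagonal]
    by_cases hj : d j = 0
    · have : (R₁ * (Qᵀ * R₂)ᵀ) i j = 0 := by
        rw [Matrix.mul_apply]
        refine Finset.sum_eq_zero fun l _ => ?_
        rw [Matrix.transpose_apply, hrow j hj, mul_zero]
      rw [this, zero_mul]
    · rw [inv_mul_cancel₀ hj, mul_one]
  -- This is `R₁ R₂ᵀ C⁺`, with `C⁺` the pseudoinverse of `C = R₂ R₂ᵀ`.
  refine ⟨R₁ * (Qᵀ * R₂)ᵀ * Matrix.diagonal (fun j => (d j)⁻¹) * Qᵀ, ?_⟩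
  calc R₁ * R₂ᵀ = R₁ * (Qᵀ * R₂)ᵀ * Qᵀ := by
        rw [Matrix.transpose_mul, Matrix.transpose_transpose]
        simp only [Matrix.mul_assoc]
        rw [hQ2, Matrix.mul_one]
    _ = R₁ * (Qᵀ * R₂)ᵀ * (Matrix.diagonal (fun j => (d j)⁻¹) * Matrix.diagonal d) * Qᵀ := by
        rw [hfac]
    _ = _ := by
        rw [hd]
        simp only [Matrix.mul_assoc]
        rw [← Matrix.mul_assoc Qᵀ Q, hQ1, Matrix.one_mul]

/-- A nonnegative multiple of the difference of a positive semidefinite matrix and a matrix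
supported on the first diagonal block. -/
theorem exists_blocks_of_posSemidef {r q : ℕ} {S : Matrix (Fin r ⊕ Fin q) (Fin r ⊕ Fin q) ℝ}
    (hS : S.PosSemidef) {Δ : Matrix (Fin r) (Fin r) ℝ} (hΔ : Δ.IsSymm)
    (htr : S.trace = (Matrix.fromBlocks Δ 0 0 0 : Matrix (Fin r ⊕ Fin q) _ ℝ).trace)
    {t : ℝ} (ht : 0 ≤ t) :
    ∃ (A : Matrix (Fin r) (Fin r) ℝ) (B : Matrix (Fin r) (Fin q) ℝ) (C : Matrix (Fin q) (Fin q) ℝ),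
      A.IsSymm ∧ C.PosSemidef ∧ A.trace + C.trace = 0 ∧
      t • (S - Matrix.fromBlocks Δ 0 0 0) =
        Matrix.fromBlocks A (B * C) (Cᵀ * Bᵀ) C := by
  obtain ⟨k, R, rfl⟩ := exists_eq_mul_transpose_of_posSemidef hS
  set R₁ := R.toRows₁
  set R₂ := R.toRows₂
  have hR : R * Rᵀ = Matrix.fromBlocks (R₁ * R₁ᵀ) (R₁ * R₂ᵀ) (R₂ * R₁ᵀ) (R₂ * R₂ᵀ) := by
    ext (i | i) (j | j) <;> rfl
  obtain ⟨B, hB⟩ := exists_mul_gram_eq R₁ R₂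
  -- `B` is not scaled: the factor `t` of the off-diagonal block `B C` is already carried by `C`.
  refine ⟨t • (R₁ * R₁ᵀ - Δ), B, t • (R₂ * R₂ᵀ), ?_, ?_, ?_, ?_⟩
  · refine Matrix.IsSymm.smul (Matrix.IsSymm.sub ?_ hΔ) t
    rw [Matrix.IsSymm, Matrix.transpose_mul, Matrix.transpose_transpose]
  · refine Matrix.PosSemidef.smul ?_ ht
    simpa using Matrix.posSemidef_self_mul_conjTranspose R₂
  · rw [hR, trace_fromBlocks_sum, trace_fromBlocks_sum, Matrix.trace_zero] at htr
    rw [Matrix.trace_smul, Matrix.trace_smul, Matrix.trace_sub, smul_eq_mul, smul_eq_mul,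
      ← mul_add]
    rw [show (R₁ * R₁ᵀ).trace - Δ.trace + (R₂ * R₂ᵀ).trace = 0 by linarith, mul_zero]
  · have hB' : R₂ * R₁ᵀ = (R₂ * R₂ᵀ)ᵀ * Bᵀ := by
      rw [← Matrix.transpose_mul, ← hB, Matrix.transpose_mul, Matrix.transpose_transpose]
    rw [hR, sub_eq_add_neg, Matrix.fromBlocks_neg, Matrix.fromBlocks_add, Matrix.fromBlocks_smul,
      hB', Matrix.mul_smul, ← hB, Matrix.transpose_smul, Matrix.smul_mul]
    simp [sub_eq_add_neg]

theorem posSemidef_fromBlocks_diag {r q : ℕ} {A : Matrix (Fin r) (Fin r) ℝ}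
    {C : Matrix (Fin q) (Fin q) ℝ} (hA : A.PosSemidef) (hC : C.PosSemidef) :
    (Matrix.fromBlocks A 0 0 C).PosSemidef := by
  obtain ⟨k, R, rfl⟩ := exists_eq_mul_transpose_of_posSemidef hA
  obtain ⟨l, T, rfl⟩ := exists_eq_mul_transpose_of_posSemidef hC
  have : Matrix.fromBlocks (R * Rᵀ) 0 0 (T * Tᵀ) =
      Matrix.fromBlocks R 0 0 T * (Matrix.fromBlocks R 0 0 T)ᴴ := by
    simp only [Matrix.fromBlocks_transpose, Matrix.fromBlocks_multiply,
      Matrix.conjTranspose_eq_transpose_of_trivial]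
    simp
  rw [this]
  exact Matrix.posSemidef_self_mul_conjTranspose _

/-- A small symmetric perturbation of a positive diagonal matrix is positive semidefinite. -/
theorem eventually_posSemidef_diagonal_add_smul {r : ℕ} {δ : Fin r → ℝ} (hδ : ∀ i, 0 < δ i)
    {K : Matrix (Fin r) (Fin r) ℝ} (hK : K.IsSymm) :
    ∀ᶠ t : ℝ in 𝓝[>] 0, (Matrix.diagonal δ + t • K).PosSemidef := by
  -- For such `t` the diagonal `δ` dominates the absolute row sums of `t K`, which suffices as `K`
  -- is symmetric.
  have hev : ∀ᶠ t : ℝ in 𝓝[>] 0, ∀ i, t * ∑ j, |K i j| < δ i := by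
    rw [Filter.eventually_all]
    intro i
    have hc : Filter.Tendsto (fun t : ℝ => t * ∑ j, |K i j|) (𝓝[>] 0) (𝓝 0) := by
      have : Filter.Tendsto (fun t : ℝ => t * ∑ j, |K i j|) (𝓝 0) (𝓝 (0 * ∑ j, |K i j|)) :=
        (continuous_id.mul continuous_const).tendsto 0
      rw [zero_mul] at this
      exact this.mono_left nhdsWithin_le_nhds
    exact hc.eventually_lt_const (hδ i)
  filter_upwards [hev, self_mem_nhdsWithin] with t ht htpos
  have htpos : 0 < t := htpos
  refine Matrix.PosSemidef.of_dotProduct_mulVec_nonneg ?_ fun x => ?_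
  · have : (Matrix.diagonal δ + t • K).IsSymm := (Matrix.isSymm_diagonal δ).add (hK.smul t)
    rwa [Matrix.IsHermitian, Matrix.conjTranspose_eq_transpose_of_trivial]
  · have hexp : star x ⬝ᵥ ((Matrix.diagonal δ + t • K) *ᵥ x) =
        ∑ i, δ i * x i ^ 2 + t * ∑ i, ∑ j, K i j * (x i * x j) := by
      rw [Matrix.add_mulVec, dotProduct_add, Matrix.smul_mulVec, dotProduct_smul, smul_eq_mul]
      congr 1
      · simp only [dotProduct, Matrix.mulVec_diagonal, star_trivial]
        exact Finset.sum_congr rfl fun i _ => by ring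
      · simp only [dotProduct, Matrix.mulVec, star_trivial, Finset.mul_sum]
        exact Finset.sum_congr rfl fun i _ => Finset.sum_congr rfl fun j _ => by ring
    have hbound : -(∑ i, (∑ j, |K i j|) * x i ^ 2) ≤ ∑ i, ∑ j, K i j * (x i * x j) := by
      have hsw : ∑ i, ∑ j, |K i j| * x j ^ 2 = ∑ i, ∑ j, |K i j| * x i ^ 2 := by
        rw [Finset.sum_comm]
        refine Finset.sum_congr rfl fun i _ => Finset.sum_congr rfl fun j _ => ?_
        rw [hK.apply]
      have h2 : ∑ i, ∑ j, (|K i j| * x i ^ 2 + |K i j| * x j ^ 2) =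
          2 * ∑ i, (∑ j, |K i j|) * x i ^ 2 := by
        simp only [Finset.sum_add_distrib, Finset.sum_mul]
        rw [hsw]
        ring
      have h3 : -(∑ i, ∑ j, (|K i j| * x i ^ 2 + |K i j| * x j ^ 2)) ≤
          2 * ∑ i, ∑ j, K i j * (x i * x j) := by
        rw [← Finset.sum_neg_distrib, Finset.mul_sum]
        refine Finset.sum_le_sum fun i _ => ?_
        rw [← Finset.sum_neg_distrib, Finset.mul_sum]
        refine Finset.sum_le_sum fun j _ => ?_
        rcases abs_cases (K i j) with ⟨h, h'⟩ | ⟨h, h'⟩ <;> rw [h]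
        · nlinarith [mul_nonneg h' (sq_nonneg (x i + x j))]
        · nlinarith [mul_nonneg (neg_nonneg.2 h'.le) (sq_nonneg (x i - x j))]
      linarith
    rw [hexp]
    have h4 : ∑ i, (t * ∑ j, |K i j|) * x i ^ 2 ≤ ∑ i, δ i * x i ^ 2 :=
      Finset.sum_le_sum fun i _ => mul_le_mul_of_nonneg_right (ht i).le (sq_nonneg _)
    have h5 : ∑ i, (t * ∑ j, |K i j|) * x i ^ 2 = t * ∑ i, (∑ j, |K i j|) * x i ^ 2 := by
      rw [Finset.mul_sum]
      exact Finset.sum_congr rfl fun i _ => mul_assoc _ _ _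
    have h6 := mul_le_mul_of_nonneg_left hbound htpos.le
    linarith

/-- The matrix is congruent, through `[[1, B], [0, 1]]`, to the block diagonal matrix with blocks
`diag δ + t (A - B C Bᵀ)` and `t C`. The form `B C` of the off-diagonal block makes the Schur
complement affine in `t`. -/
theorem exists_posSemidef_add_smul_blocks {r q : ℕ} {δ : Fin r → ℝ} (hδ : ∀ i, 0 < δ i)
    {A : Matrix (Fin r) (Fin r) ℝ} {B : Matrix (Fin r) (Fin q) ℝ} {C : Matrix (Fin q) (Fin q) ℝ}
    (hA : A.IsSymm) (hC : C.PosSemidef) :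
    ∃ t : ℝ, 0 < t ∧ (Matrix.fromBlocks (Matrix.diagonal δ) 0 0 0 +
      t • Matrix.fromBlocks A (B * C) (Cᵀ * Bᵀ) C).PosSemidef := by
  have hCs : Cᵀ = C := by simpa [Matrix.IsHermitian] using hC.isHermitian
  have hK : (A - B * C * Bᵀ).IsSymm := by
    refine hA.sub ?_
    simp only [Matrix.IsSymm, Matrix.transpose_mul, Matrix.transpose_transpose, hCs,
      Matrix.mul_assoc]
  obtain ⟨t, ht, htpos⟩ :=
    ((eventually_posSemidef_diagonal_add_smul hδ hK).and self_mem_nhdsWithin).exists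
  have htpos : 0 < t := htpos
  refine ⟨t, htpos, ?_⟩
  have h := (posSemidef_fromBlocks_diag ht (hC.smul htpos.le)).mul_mul_conjTranspose_same
    (Matrix.fromBlocks 1 B 0 1 : Matrix (Fin r ⊕ Fin q) (Fin r ⊕ Fin q) ℝ)
  convert h using 1
  simp only [Matrix.fromBlocks_transpose, Matrix.fromBlocks_multiply,
    Matrix.conjTranspose_eq_transpose_of_trivial, Matrix.fromBlocks_smul, Matrix.fromBlocks_add,
    hCs]
  simp [smul_sub]
  abel

/-! ### Critical cone and descent directions -/

theorem eq_zero_of_nuclearNorm_eq_zero {n₁ n₂ : ℕ} (hn : n₁ ≤ n₂)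
    {X : Matrix (Fin n₁) (Fin n₂) ℝ} (h : nuclearNorm X = 0) : X = 0 := by
  obtain ⟨P, Q, hX, hP, -⟩ := exists_factorization hn X
  rw [h, ← Matrix.conjTranspose_eq_transpose_of_trivial,
    Matrix.trace_conjTranspose_mul_self_eq_zero_iff] at hP
  rw [hX, hP, Matrix.zero_mul]

/-- Along a line the norm is convex, so its right derivative at `0` exists and is at most the slope
to `t`, which is negative. -/
theorem mem_criticalCone_of_lt {n₁ n₂ : ℕ} (hn : n₁ ≤ n₂) {X₀ W : Matrix (Fin n₁) (Fin n₂) ℝ}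
    {t : ℝ} (ht : 0 < t) (h : nuclearNorm (X₀ + t • W) < nuclearNorm X₀) :
    W ∈ criticalCone nuclearNorm X₀ := by
  set f : ℝ → ℝ := fun s => nuclearNorm (X₀ + s • W) with hf
  have hconv : ConvexOn ℝ Set.univ f := by
    refine ⟨convex_univ, fun x _ y _ a b ha hb hab => ?_⟩
    have := (convexOn_nuclearNorm hn).2 (Set.mem_univ (X₀ + x • W)) (Set.mem_univ (X₀ + y • W))
      ha hb hab
    have he : a • (X₀ + x • W) + b • (X₀ + y • W) = X₀ + (a • x + b • y) • W := by
      simp only [smul_add, smul_smul, add_smul, smul_eq_mul]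
      rw [add_add_add_comm, ← add_smul, hab, one_smul]
    rwa [he] at this
  have hd := hconv.hasDerivWithinAt_rightDeriv_of_mem_interior (x := 0) (by simp)
  refine ⟨_, ?_, (hconv.le_slope_of_hasDerivWithinAt_Ioi (Set.mem_univ 0) (Set.mem_univ t) ht
    hd).trans ?_⟩
  · rw [hasDerivWithinAt_iff_tendsto_slope' (by simp)] at hd
    refine hd.congr fun s => ?_
    simp [slope_def_field, hf]
  · rw [slope_def_field]
    refine div_nonpos_of_nonpos_of_nonneg ?_ (by linarith)
    simp only [hf, zero_smul, add_zero]
    linarith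

/-- By continuity a strict decrease persists for all nearby directions. -/
theorem smul_sub_mem_interior_criticalCone {n₁ n₂ : ℕ} (hn : n₁ ≤ n₂)
    {X X₀ : Matrix (Fin n₁) (Fin n₂) ℝ} {t : ℝ} (ht : 0 < t)
    (h : nuclearNorm X < nuclearNorm X₀) :
    t • (X - X₀) ∈ interior (criticalCone nuclearNorm X₀) := by
  rw [mem_interior]
  refine ⟨{W | nuclearNorm (X₀ + t⁻¹ • W) < nuclearNorm X₀},
    fun W hW => mem_criticalCone_of_lt hn (inv_pos.2 ht) hW, ?_, ?_⟩
  · exact isOpen_lt ((continuous_nuclearNorm hn).comp (by fun_prop)) continuous_const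
  · simpa [smul_smul, inv_mul_cancel₀ ht.ne'] using h

theorem mem_descentCone_of_le {n₁ n₂ : ℕ} {X₀ W : Matrix (Fin n₁) (Fin n₂) ℝ} {t : ℝ}
    (ht : 0 < t) (h : nuclearNorm (X₀ + t • W) ≤ nuclearNorm X₀) :
    W ∈ descentCone nuclearNorm X₀ :=
  ⟨t⁻¹, inv_nonneg.2 ht.le, _, h, by simp [smul_smul, inv_mul_cancel₀ ht.ne']⟩

theorem interior_criticalCone_subset {n₁ n₂ : ℕ} (hn : n₁ ≤ n₂)
    (X₀ : Matrix (Fin n₁) (Fin n₂) ℝ) :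
    interior (criticalCone nuclearNorm X₀) ⊆ descentCone nuclearNorm X₀ := by
  intro W hW
  set ν := nuclearNorm X₀ with hν
  have hν0 : 0 ≤ ν := nuclearNorm_nonneg X₀
  obtain ⟨ε, hε, hεW⟩ : ∃ ε : ℝ, 0 < ε ∧ W + ε • X₀ ∈ criticalCone nuclearNorm X₀ := by
    have hc : Filter.Tendsto (fun ε : ℝ => W + ε • X₀) (𝓝 0) (𝓝 W) := by
      have : Continuous fun ε : ℝ => W + ε • X₀ := by fun_prop
      simpa using this.tendsto 0
    have hc' : Filter.Tendsto (fun ε : ℝ => W + ε • X₀) (𝓝[>] 0) (𝓝 W) :=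
      hc.mono_left nhdsWithin_le_nhds
    have hev := hc'.eventually (mem_interior_iff_mem_nhds.1 hW)
    obtain ⟨ε, h1, h2⟩ := (hev.and self_mem_nhdsWithin).exists
    exact ⟨ε, h2, h1⟩
  -- If `X₀ = 0` there is no slack `ε ‖X₀‖_*`, but the directional derivative is then `‖W‖_*`
  -- itself.
  rcases hν0.eq_or_lt with h0 | hpos
  · obtain ⟨d, hd, hd0⟩ := interior_subset hW
    refine mem_descentCone_of_le zero_lt_one ?_
    have hX₀ : X₀ = 0 := eq_zero_of_nuclearNorm_eq_zero hn h0.symm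
    have hW0 : nuclearNorm W ≤ 0 := by
      refine le_trans (ge_of_tendsto hd ?_) hd0
      filter_upwards [self_mem_nhdsWithin] with t ht
      have ht : 0 < t := ht
      rw [← hν, ← h0, sub_zero, hX₀, zero_add, nuclearNorm_smul hn ht.le,
        mul_div_cancel_left₀ _ ht.ne']
    rw [← hν, ← h0, hX₀, zero_add, one_smul]
    exact hW0
  · obtain ⟨d, hd, hd0⟩ := hεW
    -- The derivative along `W + ε X₀` is below `ε ν`, so some `s > 0` gives a norm below `(1 + s ε)
    -- ν`. Dividing the point by `1 + s ε` leaves `X₀` plus a positive multiple of `W`, with norm at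
    -- most `ν`.
    have hev := hd.eventually_lt_const (lt_of_le_of_lt hd0 (mul_pos hε hpos))
    obtain ⟨s, hs, hs0⟩ := (hev.and self_mem_nhdsWithin).exists
    have hs0 : 0 < s := hs0
    rw [← hν, div_lt_iff₀ hs0] at hs
    have hden : 0 < 1 + s * ε := by positivity
    refine mem_descentCone_of_le (t := s / (1 + s * ε)) (by positivity) ?_
    have he : X₀ + (s / (1 + s * ε)) • W = (1 + s * ε)⁻¹ • (X₀ + s • (W + ε • X₀)) := by
      rw [eq_inv_smul_iff₀ hden.ne', smul_add, smul_smul, mul_div_cancel₀ _ hden.ne', add_smul,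
        one_smul, smul_add, smul_smul]
      abel
    rw [he, nuclearNorm_smul hn (inv_nonneg.2 hden.le), ← hν, inv_mul_le_iff₀ hden]
    linarith

/-! ### Block matrices and the descent cone -/

theorem traceZeroBlocks_subset_descentCone {n₁ n₂ q : ℕ} (hn : n₁ ≤ n₂)
    {X₀ : Matrix (Fin n₁) (Fin n₂) ℝ} (hq : X₀.rank + q ≤ n₁) {U : Matrix (Fin n₁) (Fin n₁) ℝ}
    {V : Matrix (Fin n₂) (Fin n₂) ℝ} (hUV : (U, V) ∈ svdPairs X₀) :
    traceZeroBlocks X₀.rank q U V ⊆ descentCone nuclearNorm X₀ := by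
  rintro W ⟨A, B, C, hA, hC, htr, hW⟩
  obtain ⟨hU, hV, hX₀⟩ := hUV
  simp only at hU hV hX₀
  obtain ⟨t, ht, hpsd⟩ := exists_posSemidef_add_smul_blocks
    (δ := fun i : Fin X₀.rank => sigma X₀ i) (fun i => (sigma_pos_iff X₀ i).2 i.isLt)
    (B := B) hA hC
  have hle := nuclearNorm_padBlock_le hn hq hU hV hpsd
  refine mem_descentCone_of_le ht ?_
  have he : X₀ + t • W = U * padBlock n₁ n₂
      (Matrix.fromBlocks (Matrix.diagonal fun i : Fin X₀.rank => sigma X₀ i) 0 0 0 +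
        t • Matrix.fromBlocks A (B * C) (Cᵀ * Bᵀ) C) * Vᵀ := by
    rw [padBlock_add_smul, hW, Matrix.mul_add, Matrix.add_mul, Matrix.mul_smul, Matrix.smul_mul]
    congr 1
    exact hX₀.trans (by rw [diagSigma_eq_padBlock X₀ q]; rfl)
  rw [he]
  refine hle.trans (le_of_eq ?_)
  rw [Matrix.trace_add, Matrix.trace_smul, trace_fromBlocks_sum A, htr, smul_zero, add_zero]
  exact trace_sigmaBlock X₀ q

theorem smul_sub_mem_traceZeroBlocks {n₁ n₂ q : ℕ} {X X₀ : Matrix (Fin n₁) (Fin n₂) ℝ}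
    {U : Matrix (Fin n₁) (Fin n₁) ℝ} {V : Matrix (Fin n₂) (Fin n₂) ℝ}
    (hUV : (U, V) ∈ svdPairs X₀)
    {S : Matrix (Fin X₀.rank ⊕ Fin q) (Fin X₀.rank ⊕ Fin q) ℝ} (hS : S.PosSemidef)
    (htr : S.trace = nuclearNorm X₀) (hX : X = U * padBlock n₁ n₂ S * Vᵀ) {t : ℝ} (ht : 0 ≤ t) :
    t • (X - X₀) ∈ traceZeroBlocks X₀.rank q U V := by
  obtain ⟨-, -, hX₀⟩ := hUV
  simp only at hX₀
  obtain ⟨A, B, C, hA, hC, h0, hM⟩ := exists_blocks_of_posSemidef hS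
    (Matrix.isSymm_diagonal fun i : Fin X₀.rank => sigma X₀ i)
    (htr.trans (trace_sigmaBlock X₀ q).symm) ht
  refine ⟨A, B, C, hA, hC, h0, ?_⟩
  have hX₀' : X₀ = U * padBlock n₁ n₂ (Matrix.fromBlocks
      (Matrix.diagonal fun i : Fin X₀.rank => sigma X₀ i) 0 0 0 :
        Matrix (Fin X₀.rank ⊕ Fin q) _ ℝ) * Vᵀ :=
    hX₀.trans (by rw [diagSigma_eq_padBlock X₀ q]; rfl)
  have hsub : X - X₀ = U * padBlock n₁ n₂ S * Vᵀ - U * padBlock n₁ n₂ (Matrix.fromBlocks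
      (Matrix.diagonal fun i : Fin X₀.rank => sigma X₀ i) 0 0 0 :
        Matrix (Fin X₀.rank ⊕ Fin q) _ ℝ) * Vᵀ := congrArg₂ (· - ·) hX hX₀'
  rw [← hM, hsub]
  simp only [padBlock_eq, Matrix.mul_sub, Matrix.sub_mul, Matrix.mul_smul, Matrix.smul_mul]

/-- An orthogonal matrix of size `n₁` acts on the last factor of `[I 0]` through an orthogonal
matrix of size `n₂`. -/
theorem exists_orthogonal_extension {n₁ n₂ : ℕ} (hn : n₁ ≤ n₂) {Q : Matrix (Fin n₁) (Fin n₁) ℝ}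
    (hQ : Q ∈ Matrix.orthogonalGroup (Fin n₁) ℝ) :
    ∃ Q' ∈ Matrix.orthogonalGroup (Fin n₂) ℝ,
      rectDiag n₁ n₂ (fun _ => 1) * Q'ᵀ = Qᵀ * rectDiag n₁ n₂ (fun _ => 1) := by
  obtain ⟨n, rfl⟩ := Nat.exists_eq_add_of_le hn
  let e : Fin (n₁ + n) ≃ Fin n₁ ⊕ Fin n := finSumFinEquiv.symm
  have hJ : rectDiag n₁ (n₁ + n) (fun _ => 1) =
      (Matrix.fromCols (1 : Matrix (Fin n₁) (Fin n₁) ℝ) (0 : Matrix (Fin n₁) (Fin n) ℝ)).submatrix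
        id e := by
    ext i j
    refine Fin.addCases (fun j => ?_) (fun j => ?_) j
    · simp [rectDiag, e, Matrix.one_apply, Fin.ext_iff]
    · have : (i : ℕ) ≠ n₁ + j := by omega
      simp [rectDiag, e, this]
  refine ⟨(Matrix.fromBlocks Q 0 0 1).submatrix e e, ?_, ?_⟩
  · rw [Matrix.mem_orthogonalGroup_iff, Matrix.transpose_submatrix, Matrix.submatrix_mul_equiv,
      Matrix.fromBlocks_transpose, Matrix.fromBlocks_multiply,
      (Matrix.mem_orthogonalGroup_iff _ _).1 hQ]
    simp
  · rw [hJ, Matrix.transpose_submatrix, Matrix.submatrix_mul_equiv, Matrix.fromBlocks_transpose,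
      Matrix.fromCols_mul_fromBlocks]
    have : Qᵀ * (Matrix.fromCols (1 : Matrix (Fin n₁) (Fin n₁) ℝ)
        (0 : Matrix (Fin n₁) (Fin n) ℝ)).submatrix id e =
        (Qᵀ * Matrix.fromCols (1 : Matrix (Fin n₁) (Fin n₁) ℝ)
        (0 : Matrix (Fin n₁) (Fin n) ℝ)).submatrix id e := rfl
    rw [this, Matrix.mul_fromCols]
    simp

theorem padBlock_mul_rectDiag {n₁ n₂ r q : ℕ} (hp : r + q = n₁)
    (S : Matrix (Fin r ⊕ Fin q) (Fin r ⊕ Fin q) ℝ) :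
    padBlock n₁ n₁ S * rectDiag n₁ n₂ (fun _ => 1) = padBlock n₁ n₂ S := by
  ext i j
  rw [Matrix.mul_apply]
  by_cases hj : (j : ℕ) < n₁
  · rw [Finset.sum_eq_single ⟨j, hj⟩]
    · simp [padBlock, rectDiag]
    · intro l _ hl
      have : (l : ℕ) ≠ j := fun h => hl (Fin.ext h)
      simp [rectDiag, this]
    · simp
  · rw [Finset.sum_eq_zero]
    · simp [padBlock, hp, hj]
    · intro l _
      have : (l : ℕ) ≠ j := by omega
      simp [rectDiag, this]

/-- A matrix `[I 0]` in orthogonal bases which attains the nuclear norm of `X₀` can be written in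
bases of a singular value decomposition of `X₀`. -/
theorem exists_svdPair_of_frobInner_eq {n₁ n₂ : ℕ} (hn : n₁ ≤ n₂)
    {X₀ : Matrix (Fin n₁) (Fin n₂) ℝ}
    {U : Matrix (Fin n₁) (Fin n₁) ℝ} {V : Matrix (Fin n₂) (Fin n₂) ℝ}
    (hU : U ∈ Matrix.orthogonalGroup (Fin n₁) ℝ) (hV : V ∈ Matrix.orthogonalGroup (Fin n₂) ℝ)
    (h : frobInner (U * rectDiag n₁ n₂ (fun _ => 1) * Vᵀ) X₀ = nuclearNorm X₀) :
    ∃ U' V', (U', V') ∈ svdPairs X₀ ∧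
      U' * rectDiag n₁ n₂ (fun _ => 1) * V'ᵀ = U * rectDiag n₁ n₂ (fun _ => 1) * Vᵀ := by
  -- With `s = 1` throughout, the block fills all `n₁` coordinates. Diagonalizing it by `Q` and
  -- carrying `Q` across `[I 0]` gives an SVD of `X₀` and leaves the functional unchanged.
  obtain ⟨S, hS, -, hX⟩ := exists_padBlock_of_frobInner_eq (r := n₁) (q := 0) hn le_rfl hU hV
    (fun _ => zero_le_one) (fun _ => le_rfl) (fun i hi => by simpa using hi) h
  have hN : (padBlock n₁ n₁ S).PosSemidef := by
    rw [padBlock_eq]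
    simpa using hS.mul_mul_conjTranspose_same (padCol n₁ n₁ 0)
  obtain ⟨Q, hQ, d, hd, hd0, hdQ⟩ := exists_sorted_spectral hN
  obtain ⟨Q', hQ', hJ⟩ := exists_orthogonal_extension hn hQ
  let τ : ℕ → ℝ := fun i => if h : i < n₁ then d ⟨i, h⟩ else 0
  have hdτ : Matrix.diagonal d * rectDiag n₁ n₂ (fun _ => 1) = rectDiag n₁ n₂ τ := by
    ext i j
    simp [Matrix.diagonal_mul, rectDiag, τ]
  have hUQ : U * Q ∈ Matrix.orthogonalGroup (Fin n₁) ℝ := mul_mem hU hQ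
  have hVQ : V * Q' ∈ Matrix.orthogonalGroup (Fin n₂) ℝ := mul_mem hV hQ'
  have hXτ : X₀ = (U * Q) * rectDiag n₁ n₂ τ * (V * Q')ᵀ := by
    rw [hX, ← padBlock_mul_rectDiag (by simp), hdQ, ← hdτ]
    simp only [Matrix.transpose_mul, Matrix.mul_assoc]
    rw [← Matrix.mul_assoc (rectDiag n₁ n₂ _) Q'ᵀ, hJ]
    simp only [Matrix.mul_assoc]
  have hσ : rectDiag n₁ n₂ τ = diagSigma X₀ := by
    have hτ := sigma_eq_of_eq_mul hUQ hVQ (τ := τ) ?_ ?_ ?_ hXτ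
    · ext i j
      simp only [rectDiag, diagSigma, Matrix.of_apply]
      split_ifs with hij
      · rw [hij, hτ j]
      · rfl
    · intro i j hij
      simp only [τ]
      split_ifs with h1 h2 h2
      · exact hd (by simpa using hij)
      · omega
      · exact hd0 _
      · exact le_rfl
    · intro i
      simp only [τ]
      split_ifs
      · exact hd0 _
      · exact le_rfl
    · intro i hi
      simp [τ, not_lt.2 hi]
  refine ⟨U * Q, V * Q', ⟨hUQ, hVQ, ?_⟩, ?_⟩
  · rw [← hσ]
    exact hXτ
  · simp only [Matrix.transpose_mul, Matrix.mul_assoc]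
    rw [← Matrix.mul_assoc (rectDiag n₁ n₂ _) Q'ᵀ, hJ]
    simp only [Matrix.mul_assoc]
    rw [← Matrix.mul_assoc Q Qᵀ, (Matrix.mem_orthogonalGroup_iff _ _).1 hQ, Matrix.one_mul]

theorem descentCone_subset {n₁ n₂ : ℕ} (hn : n₁ ≤ n₂) (X₀ : Matrix (Fin n₁) (Fin n₂) ℝ) :
    descentCone nuclearNorm X₀ ⊆
      descentBoundary X₀ ∪ interior (criticalCone nuclearNorm X₀) := by
  rintro W ⟨t, ht, X, hX, rfl⟩
  -- When `t = 0` the direction is zero and `X` carries no information, so it is replaced by `X₀`.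
  wlog htX : X = X₀ ∨ 0 < t generalizing X t
  · have ht0 : t = 0 := le_antisymm (not_lt.1 fun h => htX (Or.inr h)) ht
    have := this 0 le_rfl X₀ le_rfl (Or.inl rfl)
    simpa [ht0] using this
  set Z := X₀ + (2⁻¹ : ℝ) • (X - X₀) with hZ
  have hZ' : X + X₀ = (2 : ℝ) • Z := by
    rw [hZ, smul_add, smul_smul, two_smul]
    norm_num
    abel
  have hZle : 2 * nuclearNorm Z ≤ nuclearNorm X + nuclearNorm X₀ := by
    rw [← nuclearNorm_smul hn zero_le_two, ← hZ']
    exact nuclearNorm_add_le hn X X₀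
  by_cases hlt : nuclearNorm Z < nuclearNorm X₀
  · right
    rcases htX with rfl | htpos
    · simp [hZ] at hlt
    · have := smul_sub_mem_interior_criticalCone hn (mul_pos zero_lt_two htpos) hlt
      rwa [hZ, add_sub_cancel_left, smul_smul, mul_comm 2 t, mul_assoc,
        mul_inv_cancel₀ two_ne_zero, mul_one] at this
  · left
    rw [not_lt] at hlt
    have hXeq : nuclearNorm X = nuclearNorm X₀ := by linarith
    have hZeq : nuclearNorm Z = nuclearNorm X₀ := by linarith
    obtain ⟨U, hU, V, hV, hUV⟩ := exists_frobInner_eq_nuclearNorm hn Z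
    -- These two bounds add up to an equality, by `h3` and the equal norms of `X`, `X₀` and `Z`.
    -- Hence both are equalities.
    have h1 := frobInner_le_nuclearNorm hn hU hV (fun _ => zero_le_one) (fun _ => le_rfl) X
    have h2 := frobInner_le_nuclearNorm hn hU hV (fun _ => zero_le_one) (fun _ => le_rfl) X₀
    have h3 := frobInner_add_right (U * rectDiag n₁ n₂ (fun _ => 1) * Vᵀ) X X₀
    rw [hZ', frobInner_smul_right, hUV] at h3
    obtain ⟨U', V', hUV', hY⟩ := exists_svdPair_of_frobInner_eq hn hU hV
      (X₀ := X₀) (by linarith)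
    have hr : X₀.rank + (n₁ - X₀.rank) = n₁ := Nat.add_sub_of_le (rank_le_of_fin X₀)
    have hXY : frobInner (U' * rectDiag n₁ n₂ (fun _ => 1) * V'ᵀ) X = nuclearNorm X := by
      rw [hY]
      linarith
    obtain ⟨S, hS, htr, hXS⟩ := exists_padBlock_of_frobInner_eq (r := X₀.rank)
      (q := n₁ - X₀.rank) hn hr.le hUV'.1 hUV'.2.1 (fun _ => zero_le_one) (fun _ => le_rfl)
      (fun i hi => by simpa [hr] using hi) hXY
    exact ⟨U', V', hUV', smul_sub_mem_traceZeroBlocks hUV' hS (htr.trans hXeq) hXS ht⟩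

/-! ### Subgradients -/

/-- By positive homogeneity, testing the subgradient inequality at `0` and at `2 X₀` gives the two
inequalities. -/
theorem frobInner_eq_of_mem_subdifferential {n₁ n₂ : ℕ} (hn : n₁ ≤ n₂)
    {X₀ Y : Matrix (Fin n₁) (Fin n₂) ℝ} (hY : Y ∈ subdifferential nuclearNorm X₀) :
    frobInner Y X₀ = nuclearNorm X₀ := by
  have h0 := hY 0
  have h2 := hY ((2 : ℝ) • X₀)
  rw [frobInner_sub_right, nuclearNorm_smul hn zero_le_two, frobInner_smul_right] at h2
  rw [frobInner_sub_right, nuclearNorm_zero hn, show frobInner Y 0 = 0 by simp [frobInner]] at h0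
  linarith

theorem frobInner_le_of_mem_subdifferential {n₁ n₂ : ℕ} (hn : n₁ ≤ n₂)
    {X₀ Y : Matrix (Fin n₁) (Fin n₂) ℝ} (hY : Y ∈ subdifferential nuclearNorm X₀)
    (X : Matrix (Fin n₁) (Fin n₂) ℝ) : frobInner Y X ≤ nuclearNorm X := by
  have h := hY X
  rw [frobInner_sub_right, frobInner_eq_of_mem_subdifferential hn hY] at h
  linarith

/-- The test matrix is `uᵢ vᵢᵀ`, built from singular vectors of `Y`: it has nuclear norm at most `1`
and inner product `σᵢ(Y)` with `Y`. -/
theorem sigma_le_one_of_frobInner_le {n₁ n₂ : ℕ} (hn : n₁ ≤ n₂) {Y : Matrix (Fin n₁) (Fin n₂) ℝ}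
    (hY : ∀ X, frobInner Y X ≤ nuclearNorm X) (i : ℕ) : sigma Y i ≤ 1 := by
  by_cases hi : i < n₁
  · obtain ⟨⟨U, V⟩, hU, hV, hUV⟩ := svdPairs_nonempty Y
    simp only at hU hV hUV
    have h := hY (U * rectDiag n₁ n₂ (Pi.single i 1) * Vᵀ)
    have hs : frobInner Y (U * rectDiag n₁ n₂ (Pi.single i 1) * Vᵀ) = sigma Y i := by
      conv_lhs => rw [hUV, diagSigma_eq_rectDiag, frobInner_svd hn hU hV]
      rw [Finset.sum_eq_single ⟨i, hi⟩]
      · simp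
      · intro l _ hl
        have : (l : ℕ) ≠ i := fun h => hl (Fin.ext h)
        simp [this]
      · simp
    let P : Matrix (Fin n₁) Unit ℝ := Matrix.of fun k _ => if (k : ℕ) = i then 1 else 0
    let Q : Matrix (Fin n₂) Unit ℝ := Matrix.of fun k _ => if (k : ℕ) = i then 1 else 0
    have hPQ : U * rectDiag n₁ n₂ (Pi.single i 1) * Vᵀ = (U * P) * (V * Q)ᵀ := by
      have : rectDiag n₁ n₂ (Pi.single i 1) = P * Qᵀ := by
        ext k l
        simp only [rectDiag, Matrix.of_apply, Pi.single_apply, Matrix.mul_apply, P, Q,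
          Matrix.transpose_apply, Finset.univ_unique, Finset.sum_singleton]
        split_ifs <;> first | omega | simp
      rw [this]
      simp only [Matrix.transpose_mul, Matrix.mul_assoc]
    have hle := nuclearNorm_mul_transpose_le hn (U * P) (V * Q)
    have hP : (Pᵀ * P).trace = 1 := by
      rw [trace_transpose_mul_self, Finset.sum_eq_single ⟨i, hi⟩]
      · simp [P]
      · intro l _ hl
        have : (l : ℕ) ≠ i := fun h => hl (Fin.ext h)
        simp [P, this]
      · simp
    have hQ : (Qᵀ * Q).trace = 1 := by
      rw [trace_transpose_mul_self, Finset.sum_eq_single ⟨i, hi.trans_le hn⟩]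
      · simp [Q]
      · intro l _ hl
        have : (l : ℕ) ≠ i := fun h => hl (Fin.ext h)
        simp [Q, this]
      · simp
    rw [trace_orthogonal_mul hU, trace_orthogonal_mul hV, hP, hQ, ← hPQ] at hle
    linarith
  · rw [sigma_eq_zero_of_le Y (not_lt.1 hi)]
    exact zero_le_one

theorem unitSingularCount_le {n₁ n₂ : ℕ} (Y : Matrix (Fin n₁) (Fin n₂) ℝ) :
    unitSingularCount Y ≤ n₁ := by
  simpa [unitSingularCount] using
    Finset.card_filter_le (Finset.univ : Finset (Fin n₁)) fun i => sigma Y i = 1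

/-- The singular values decrease and are at most `1`, so those equal to `1` occupy an initial
segment of indices. -/
theorem sigma_eq_one_iff {n₁ n₂ : ℕ} {Y : Matrix (Fin n₁) (Fin n₂) ℝ}
    (h1 : ∀ i, sigma Y i ≤ 1) {i : ℕ} (hi : i < n₁) :
    sigma Y i = 1 ↔ i < unitSingularCount Y := by
  constructor
  · intro h
    have hsub : Finset.Iic (⟨i, hi⟩ : Fin n₁) ⊆
        Finset.univ.filter fun i : Fin n₁ => sigma Y i = 1 := by
      intro j hj
      have hj' : (j : ℕ) ≤ i := Fin.le_def.1 (Finset.mem_Iic.1 hj)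
      simpa using le_antisymm (h1 j) (h.symm.le.trans (sigma_antitone Y hj'))
    have := Finset.card_le_card hsub
    rw [Fin.card_Iic] at this
    exact this
  · intro h
    by_contra hne
    have hsub : (Finset.univ.filter fun i : Fin n₁ => sigma Y i = 1) ⊆
        Finset.Iio (⟨i, hi⟩ : Fin n₁) := by
      intro j hj
      have hj' : sigma Y j = 1 := by simpa using hj
      rw [Finset.mem_Iio]
      by_contra hij
      have hij : i ≤ (j : ℕ) := not_lt.1 hij
      exact hne (le_antisymm (h1 i) (hj'.symm.le.trans (sigma_antitone Y hij)))
    have := Finset.card_le_card hsub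
    rw [Fin.card_Iio] at this
    exact absurd h (not_lt.2 this)

/-- In common bases `⟨Y, X₀⟩ = ∑ σᵢ(Y) σᵢ(X₀)` must equal `∑ σᵢ(X₀)`, so `σᵢ(Y) = 1` wherever
`σᵢ(X₀) > 0`. This makes the truncated subtraction `p - r` a true one. -/
theorem rank_le_unitSingularCount {n₁ n₂ : ℕ} (hn : n₁ ≤ n₂) {X₀ Y : Matrix (Fin n₁) (Fin n₂) ℝ}
    (hY : Y ∈ subdifferential nuclearNorm X₀) {U : Matrix (Fin n₁) (Fin n₁) ℝ}
    {V : Matrix (Fin n₂) (Fin n₂) ℝ} (hX : (U, V) ∈ svdPairs X₀) (hYUV : (U, V) ∈ svdPairs Y) :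
    X₀.rank ≤ unitSingularCount Y := by
  by_contra hlt
  rw [not_le] at hlt
  have h1 := sigma_le_one_of_frobInner_le hn (frobInner_le_of_mem_subdifferential hn hY)
  have hi := hlt.trans_le (rank_le_of_fin X₀)
  have hne : sigma Y (unitSingularCount Y) < 1 :=
    lt_of_le_of_ne (h1 _) fun h => lt_irrefl _ ((sigma_eq_one_iff h1 hi).1 h)
  have h := frobInner_eq_of_mem_subdifferential hn hY
  have hs : frobInner Y X₀ = ∑ i : Fin n₁, sigma Y i * sigma X₀ i := by
    have e1 : Y = U * rectDiag n₁ n₂ (sigma Y) * Vᵀ := hYUV.2.2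
    have e2 : X₀ = U * rectDiag n₁ n₂ (sigma X₀) * Vᵀ := hX.2.2
    conv_lhs => rw [e1, e2]
    exact frobInner_svd hn hX.1 hX.2.1 _ _
  rw [hs] at h
  refine ne_of_lt (Finset.sum_lt_sum (fun i _ => ?_) ⟨⟨_, hi⟩, Finset.mem_univ _, ?_⟩) h
  · exact mul_le_of_le_one_left (sigma_nonneg _ _) (h1 _)
  · exact mul_lt_of_lt_one_left ((sigma_pos_iff X₀ _).2 hlt) hne

theorem ker_inter_descentCone_subset {n₁ n₂ m : ℕ} (hn : n₁ ≤ n₂)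
    {X₀ Y : Matrix (Fin n₁) (Fin n₂) ℝ}
    {Φ : Matrix (Fin n₁) (Fin n₂) ℝ →ₗ[ℝ] EuclideanSpace ℝ (Fin m)}
    (hY : Y ∈ dualCertificates Φ X₀) {U : Matrix (Fin n₁) (Fin n₁) ℝ}
    {V : Matrix (Fin n₂) (Fin n₂) ℝ} (hX₀ : (U, V) ∈ svdPairs X₀) (hYUV : (U, V) ∈ svdPairs Y)
    {W : Matrix (Fin n₁) (Fin n₂) ℝ} (hW : Φ W = 0) (hD : W ∈ descentCone nuclearNorm X₀) :
    W ∈ traceZeroBlocks X₀.rank (unitSingularCount Y - X₀.rank) U V := by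
  obtain ⟨hYs, z, hz⟩ := hY
  have hYW : frobInner Y W = 0 := by rw [← hz, frobInner_frobAdjoint, hW, inner_zero_right]
  obtain ⟨t, ht, X, hX, rfl⟩ := hD
  wlog htX : X = X₀ ∨ 0 < t generalizing X t
  · have ht0 : t = 0 := le_antisymm (not_lt.1 fun h => htX (Or.inr h)) ht
    have := this 0 le_rfl X₀ le_rfl (by simp) (by simp [frobInner]) (Or.inl rfl)
    simpa [ht0] using this
  have hr := rank_le_unitSingularCount hn hYs hX₀ hYUV
  have hp : X₀.rank + (unitSingularCount Y - X₀.rank) = unitSingularCount Y :=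
    Nat.add_sub_of_le hr
  have hYle := frobInner_le_of_mem_subdifferential hn hYs
  have hYX₀ := frobInner_eq_of_mem_subdifferential hn hYs
  -- As `Y` is orthogonal to `Ker Φ`, it takes the same value at `X` and `X₀`. With `‖X‖_* ≤ ‖X₀‖_*`
  -- this puts `X` in the equality case for `Y`.
  have hYX : frobInner Y X = nuclearNorm X₀ := by
    rcases htX with rfl | htpos
    · exact hYX₀
    · rw [frobInner_smul_right, frobInner_sub_right, hYX₀] at hYW
      have := (mul_eq_zero.1 hYW).resolve_left htpos.ne'
      linarith
  have hXeq : nuclearNorm X = nuclearNorm X₀ := le_antisymm hX (hYX ▸ hYle X)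
  have h1 := sigma_le_one_of_frobInner_le hn hYle
  have hYe : Y = U * rectDiag n₁ n₂ (sigma Y) * Vᵀ := hYUV.2.2
  obtain ⟨S, hS, htr, hXS⟩ := exists_padBlock_of_frobInner_eq (r := X₀.rank)
    (q := unitSingularCount Y - X₀.rank) (X := X) hn (hp.le.trans (unitSingularCount_le Y)) hX₀.1
    hX₀.2.1 (sigma_nonneg Y) h1 (fun i hi => by rw [hp]; exact sigma_eq_one_iff h1 hi)
    (by rw [← hYe, hYX, hXeq])
  exact smul_sub_mem_traceZeroBlocks hX₀ hS (htr.trans hXeq) hXS ht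

end

theorem proposition4p16 {n₁ n₂ : ℕ} (hn : n₁ ≤ n₂) (X₀ : Matrix (Fin n₁) (Fin n₂) ℝ) :
    descentCone nuclearNorm X₀ =
        descentBoundary X₀ ∪ interior (criticalCone nuclearNorm X₀) ∧
    ∀ (m : ℕ) (Φ : Matrix (Fin n₁) (Fin n₂) ℝ →ₗ[ℝ] EuclideanSpace ℝ (Fin m))
      (M₀ : EuclideanSpace ℝ (Fin m)), IsOptimalSolution Φ M₀ X₀ →
      ∀ Y ∈ dualCertificates Φ X₀, ∀ U V, (U, V) ∈ svdPairs X₀ ∩ svdPairs Y →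
        (LinearMap.ker Φ : Set (Matrix (Fin n₁) (Fin n₂) ℝ)) ∩ descentCone nuclearNorm X₀ =
          (LinearMap.ker Φ : Set (Matrix (Fin n₁) (Fin n₂) ℝ)) ∩
            traceZeroBlocks X₀.rank (unitSingularCount Y - X₀.rank) U V := by
  refine ⟨subset_antisymm (descentCone_subset hn X₀)
    (Set.union_subset ?_ (interior_criticalCone_subset hn X₀)), ?_⟩
  · rintro W ⟨U, V, hUV, hW⟩
    exact traceZeroBlocks_subset_descentCone hn (Nat.add_sub_of_le (rank_le_of_fin X₀)).le hUV hW
  · rintro m Φ M₀ - Y hY U V ⟨hX₀, hYUV⟩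
    have hr := rank_le_unitSingularCount hn hY.1 hX₀ hYUV
    ext W
    refine ⟨fun hW => ⟨hW.1, ?_⟩, fun hW => ⟨hW.1, ?_⟩⟩
    · exact ker_inter_descentCone_subset hn hY hX₀ hYUV hW.1 hW.2
    · refine traceZeroBlocks_subset_descentCone hn ?_ hX₀ hW.2
      rw [Nat.add_sub_of_le hr]
      exact unitSingularCount_le Y
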